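/- Write $\langle x\rangle=(1+x^2)^{1/2}$ and describe functions of $x\in\mathbb T=\mathbb R/2\pi\mathbb Z$ by their Fourier coefficients $\hat f(n)$, $n\in\mathbb Z$. For $\varepsilon\in\{+1,-1\}$ and $s,b\in\mathbb R$ put $$\|u\|_{X^{\varepsilon}_{s,b}}=\Big(\sum_{n\neq 0}\int_{\mathbb R}(1+|\tau-\varepsilon n^2|)^{2b}\langle n\rangle^{2s}|\widehat{u_n}(\tau)|^2\,d\tau\Big)^{1/2},\qquad u(t,x)=\sum_{n\ne0}u_n(t)e^{inx},\quad u_n(t)=\int_{\mathbb R}\widehat{u_n}(\tau)e^{it\tau}\,d\tau ,$$ where each $\widehat{u_n}$ is integrable (this is automatic for finite norm if $b>1/2$; the norm is $\infty$ if some $u_n$ is not of this form); $X^\varepsilon_{s,b}$ denotes the functions $u$ with spatial mean zero at every time and finite norm. With $L=(\partial_x^4-\partial_x^2)^{1/2}$ (symbol $|n|\langle n\rangle$, inverted on mean-zero functions), let $$\mathcal N(u,v)=L^{-1}\langle\nabla\rangle^{-\alpha}\partial_x^2\big(\langle\nabla\rangle^{\alpha}u\;\langle\nabla\rangle^{\alpha}v\big),$$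 and, for $\varepsilon_1,\varepsilon_2\in\{+1,-1\}$, $$T^{\varepsilon_1,\varepsilon_2}(u,v)=-\frac12\sum_{\xi\eta(\xi+\eta)\ne0}\frac{|\xi+\eta|\,\langle\xi\rangle^\alpha\langle\eta\rangle^\alpha\,\hat u(\xi)\hat v(\eta)\,e^{i(\xi+\eta)x}}{\langle\xi+\eta\rangle^{1+\alpha}\big[\varepsilon_1|\xi|\langle\xi\rangle+\varepsilon_2|\eta|\langle\eta\rangle-|\xi+\eta|\langle\xi+\eta\rangle\big]},$$ both acting at each fixed time $t$. **Lemma (trilinear estimate).** Let $0\le\alpha<1/2$ and $\gamma<\min(1-2\alpha,1/2)$. There is $\delta_0>0$ such that for all $\delta,\delta'\in(0,\delta_0)$ there is a constant $C$ such that, for all $\varepsilon_1,\varepsilon_2,\varepsilon_3\in\{+1,-1\}$ and all $u\in X^{\varepsilon_1}_{0,1/2+\delta}$, $v\in X^{\varepsilon_2}_{0,1/2+\delta}$, $w\in X^{\varepsilon_3}_{0,1/2+\delta}$, the series defining the Fourier coefficients of $T^{\varepsilon_1,\varepsilon_2}(u,v)$ and of the product in $\mathcal N(T^{\varepsilon_1,\varepsilon_2}(u,v),w)$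 converge absolutely at every time, and $$\|\mathcal N(T^{\varepsilon_1,\varepsilon_2}(u,v),w)\|_{X^{+}_{\gamma,-1/2+\delta'}}\le C\,\|u\|_{X^{\varepsilon_1}_{0,1/2+\delta}}\|v\|_{X^{\varepsilon_2}_{0,1/2+\delta}}\|w\|_{X^{\varepsilon_3}_{0,1/2+\delta}}.$$ -/

import Mathlib

open MeasureTheory
open scoped ENNReal NNReal

namespace Boussinesq

/-- The Japanese bracket `⟨x⟩ = (1 + x²)^{1/2}`. -/
noncomputable def bracket (x : ℝ) : ℝ := Real.sqrt (1 + x ^ 2)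

/-! ### Operators on the circle, acting on sequences of Fourier coefficients

A function (or distribution) `f` on the circle of length `2π` is represented by the sequence
`f : ℤ → ℂ` of its Fourier coefficients. -/

/-- The Fourier multiplier with symbol `m`. -/
noncomputable def multiplier (m : ℤ → ℝ) (f : ℤ → ℂ) : ℤ → ℂ := fun n => (m n : ℂ) * f n

/-- `⟨∇⟩^s`, the multiplier with symbol `⟨n⟩^s`. -/
noncomputable def bracketNabla (s : ℝ) : (ℤ → ℂ) → ℤ → ℂ :=
  multiplier fun n => bracket n ^ s

/-- `∂_x²`, the multiplier with symbol `-n²`. -/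
noncomputable def dxx : (ℤ → ℂ) → ℤ → ℂ := multiplier fun n => -(n : ℝ) ^ 2

/-- `L⁻¹`, where `L = (∂_x⁴ - ∂_x²)^{1/2}` has symbol `|n|⟨n⟩`; the zero mode is dropped. -/
noncomputable def invL : (ℤ → ℂ) → ℤ → ℂ :=
  multiplier fun n => if n = 0 then 0 else (|(n : ℝ)| * bracket n)⁻¹

/-- Fourier coefficients of the pointwise product of two functions. -/
noncomputable def prodCoeff (f g : ℤ → ℂ) : ℤ → ℂ := fun n => ∑' ξ : ℤ, f ξ * g (n - ξ)

/-- The nonlinearity `N(f, g) = L⁻¹ ⟨∇⟩^{-α} ∂_x² (⟨∇⟩^α f · ⟨∇⟩^α g)`. -/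
noncomputable def nonlin (α : ℝ) (f g : ℤ → ℂ) : ℤ → ℂ :=
  invL (bracketNabla (-α) (dxx (prodCoeff (bracketNabla α f) (bracketNabla α g))))

/-- The symbol of the normal form operator `T^{ε; ε₁, ε₂}`. -/
noncomputable def normalFormSymbol (α : ℝ) (ε ε₁ ε₂ : ℤˣ) (ξ η : ℤ) : ℝ :=
  if ξ * η * (ξ + η) = 0 then 0 else
    -(1 / 2) * (|(ξ + η : ℝ)| * bracket ξ ^ α * bracket η ^ α) /
      (bracket (ξ + η) ^ (1 + α) *
        ((ε₁ : ℤ) * (|(ξ : ℝ)| * bracket ξ) + (ε₂ : ℤ) * (|(η : ℝ)| * bracket η)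
          - (ε : ℤ) * (|(ξ + η : ℝ)| * bracket (ξ + η))))

/-- The bilinear normal form operator `T^{ε; ε₁, ε₂}`. -/
noncomputable def normalForm (α : ℝ) (ε ε₁ ε₂ : ℤˣ) (f g : ℤ → ℂ) : ℤ → ℂ := fun n =>
  ∑' ξ : ℤ, (normalFormSymbol α ε ε₁ ε₂ ξ (n - ξ) : ℂ) * f ξ * g (n - ξ)

/-! ### Space-time functions and the Bourgain spaces

A space-time function `u` on `ℝ × 𝕋` is represented by `u : ℝ → ℤ → ℂ`, where `u t n` is the `n`-th
spatial Fourier coefficient of `u(t, ·)`. -/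

/-- `H` is the Fourier transform of `h` in the time variable, with the normalization
`h(t) = ∫ H(τ) e^{itτ} dτ`, that is `H(τ) = (2π)⁻¹ ∫ h(t) e^{-itτ} dt`. -/
def IsTimeFourier (h H : ℝ → ℂ) : Prop :=
  Integrable H ∧ ∀ t : ℝ, h t = ∫ τ : ℝ, H τ * Complex.exp (Complex.I * t * τ)

/-- For `U n` the time Fourier transform of the `n`-th mode, the quantity
`(∑_{n ≠ 0} ∫ (1 + |τ - ε n²|)^{2b} ⟨n⟩^{2s} |U n τ|² dτ)^{1/2}`, with values in `[0, ∞]`. -/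
noncomputable def xWeighted (ε : ℤˣ) (s b : ℝ) (U : ℤ → ℝ → ℂ) : ℝ≥0∞ :=
  (∑' n : {n : ℤ // n ≠ 0}, ∫⁻ τ : ℝ,
    ENNReal.ofReal ((1 + |τ - (ε : ℤ) * (n : ℝ) ^ 2|) ^ (2 * b) * bracket n ^ (2 * s)) *
      ‖U n τ‖ₑ ^ 2) ^ (1 / 2 : ℝ)

/-- The norm of `X^ε_{s,b}`, with values in `[0, ∞]`. The transform of each mode is unique up to
null sets, so the infimum is over equal values (see `xNorm_eq`); the norm is `∞` if some mode has
no integrable time Fourier transform. (For `b > 1/2`, finiteness of the weighted integrals makes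
the transforms integrable.) -/
noncomputable def xNorm (ε : ℤˣ) (s b : ℝ) (u : ℝ → ℤ → ℂ) : ℝ≥0∞ :=
  ⨅ (U : ℤ → ℝ → ℂ) (_ : ∀ n, IsTimeFourier (fun t => u t n) (U n)), xWeighted ε s b U

/-- Membership in `X^ε_{s,b}`: spatial mean zero at all times, and finite norm. -/
def MemX (ε : ℤˣ) (s b : ℝ) (u : ℝ → ℤ → ℂ) : Prop :=
  (∀ t, u t 0 = 0) ∧ xNorm ε s b u < ∞

theorem fourier_eq_of_isTimeFourier {h H : ℝ → ℂ} (hH : IsTimeFourier h H) (x : ℝ) :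
    FourierTransform.fourier H x = h (-(2 * Real.pi * x)) := by
  rw [hH.2, Real.fourier_eq']
  refine integral_congr_ae (Filter.Eventually.of_forall fun τ => ?_)
  simp only [smul_eq_mul]
  rw [mul_comm]
  congr 2
  simp
  ring

theorem IsTimeFourier.ae_eq {h H₁ H₂ : ℝ → ℂ} (h₁ : IsTimeFourier h H₁)
    (h₂ : IsTimeFourier h H₂) : H₁ =ᵐ[volume] H₂ := by
  refine ae_eq_of_integral_contDiff_smul_eq h₁.1.locallyIntegrable h₂.1.locallyIntegrable ?_
  intro g hg hgs
  have hgs' : HasCompactSupport fun x => (g x : ℂ) := hgs.comp_left (g := fun y : ℝ => (y : ℂ)) rfl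
  let G : SchwartzMap ℝ ℂ := hgs'.toSchwartzMap (Complex.ofRealCLM.contDiff.comp hg)
  let φ : SchwartzMap ℝ ℂ := FourierTransformInv.fourierInv G
  have key : ∀ H : ℝ → ℂ, IsTimeFourier h H →
      ∫ x, g x • H x = ∫ x, φ x * h (-(2 * Real.pi * x)) := by
    intro H hH
    have e : ∀ x, ((g x : ℝ) : ℂ) = FourierTransform.fourier (φ : ℝ → ℂ) x := by
      intro x
      have : FourierTransform.fourier φ = G := FourierTransform.fourier_fourierInv_eq G
      rw [← SchwartzMap.fourier_coe, this]
      rfl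
    have k := VectorFourier.integral_bilin_fourierIntegral_eq_flip (ContinuousLinearMap.mul ℂ ℂ)
      (L := innerₗ ℝ) Real.continuous_fourierChar continuous_inner (φ.integrable (μ := volume)) hH.1
    calc ∫ x, g x • H x = ∫ x, FourierTransform.fourier (φ : ℝ → ℂ) x * H x := by
          refine integral_congr_ae (Filter.Eventually.of_forall fun x => ?_)
          simp only [← e, Complex.real_smul]
      _ = ∫ x, φ x * FourierTransform.fourier H x := by simpa using! k
      _ = _ := by simp only [fourier_eq_of_isTimeFourier hH]
  rw [key H₁ h₁, key H₂ h₂]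

theorem xWeighted_congr (ε : ℤˣ) (s b : ℝ) {U V : ℤ → ℝ → ℂ} (h : ∀ n, U n =ᵐ[volume] V n) :
    xWeighted ε s b U = xWeighted ε s b V := by
  unfold xWeighted
  congr 1
  refine tsum_congr fun n => lintegral_congr_ae ?_
  filter_upwards [h n] with τ hτ
  rw [hτ]

theorem xNorm_eq (ε : ℤˣ) (s b : ℝ) {u : ℝ → ℤ → ℂ} {U : ℤ → ℝ → ℂ}
    (hU : ∀ n, IsTimeFourier (fun t => u t n) (U n)) : xNorm ε s b u = xWeighted ε s b U := by
  refine le_antisymm (iInf₂_le U hU) (le_iInf₂ fun V hV => le_of_eq ?_)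
  exact xWeighted_congr ε s b fun n => (hU n).ae_eq (hV n)

theorem isTimeFourier_schwartz (h : SchwartzMap ℝ ℂ) : IsTimeFourier h
    (fun τ => (2 * Real.pi : ℂ)⁻¹ * ∫ t : ℝ, h t * Complex.exp (-(Complex.I * t * τ))) := by
  let φ : SchwartzMap ℝ ℂ := FourierTransform.fourier h
  have e : ∀ τ : ℝ, ∫ t : ℝ, h t * Complex.exp (-(Complex.I * t * τ)) =
      φ ((2 * Real.pi)⁻¹ * τ) := by
    intro τ
    rw [SchwartzMap.fourier_coe, Real.fourier_eq']
    refine integral_congr_ae (Filter.Eventually.of_forall fun t => ?_)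
    simp only [smul_eq_mul]
    rw [mul_comm]
    congr 2
    have := Real.pi_ne_zero
    simp
    field_simp
  have hpos : (0 : ℝ) < 2 * Real.pi := by positivity
  simp only [e]
  refine ⟨(φ.integrable.comp_mul_left' (inv_ne_zero hpos.ne')).const_mul _, fun t => ?_⟩
  have inv : h t = FourierTransformInv.fourierInv (φ : ℝ → ℂ) t := by
    rw [← SchwartzMap.fourierInv_coe, FourierTransform.fourierInv_fourier_eq h]
  rw [inv, Real.fourierInv_eq']
  have cv := Measure.integral_comp_mul_left
    (fun v : ℝ => φ v * Complex.exp (Complex.I * t * (2 * Real.pi * v))) (2 * Real.pi)⁻¹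
  have hl : ∀ τ : ℝ, (2 * Real.pi : ℂ)⁻¹ * φ ((2 * Real.pi)⁻¹ * τ) * Complex.exp (Complex.I * t * τ)
      = (2 * Real.pi : ℂ)⁻¹ * (φ ((2 * Real.pi)⁻¹ * τ) *
        Complex.exp (Complex.I * t * (2 * Real.pi * (((2 * Real.pi)⁻¹ * τ : ℝ) : ℂ)))) := by
    intro τ
    have h2 : (2 * Real.pi : ℂ) ≠ 0 := by exact_mod_cast hpos.ne'
    push_cast
    rw [mul_inv_cancel_left₀ h2, mul_assoc]
  simp only [hl]
  rw [integral_const_mul, cv, inv_inv, abs_of_pos hpos, Complex.real_smul]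
  have h2 : (2 * Real.pi : ℂ) ≠ 0 := by exact_mod_cast hpos.ne'
  push_cast
  rw [inv_mul_cancel_left₀ h2]
  refine integral_congr_ae (Filter.Eventually.of_forall fun v => ?_)
  simp only [smul_eq_mul]
  rw [mul_comm]
  congr 2
  simp
  ring

end Boussinesq

/-! Let the input frequencies be ξ, η, ζ, the intermediate one m = ξ + η and the output n = m + ζ.
Since |x|⟨x⟩ lies between x² and x² + 1/2, the denominator of T is bounded below by a multiple of 1
+ |D|, where D = ε₁ξ² + ε₂η² - m² (`innerResonance`) is an integer with |D| ≥ 2. The powers of ⟨m⟩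
cancel up to |m|/⟨m⟩ ≤ 1, so the weighted multiplier is at most a constant times ⟨n⟩^{γ-α}
(⟨ξ⟩⟨η⟩⟨ζ⟩)^α / (1 + |D|).

Up to signs, the modulations of the three inputs and of the output add up to R = n² - ε₁ξ² - ε₂η² -
ε₃ζ² (`resonance`), so at least one is of size |R| or more, up to a factor 4. This gains (1 +
|R|)^{-1/2+δ'}. A factor that carries the large modulation is measured in L² of the time frequency
and the others in L¹, which b > 1/2 allows by Cauchy-Schwarz (`lintegral_modWeight_lconv_le`).
Minkowski's inequality over (m, ξ) then leaves an estimate for ℓ² sequences (`discrete_estimate`).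

For that estimate it is enough, by Cauchy-Schwarz, that the square of multiplier times gain be
summable in (m, ξ) uniformly in n. The frequencies with ξ = n or η = n, where R can vanish, are
treated apart: there the multiplier alone is bounded and the sum collapses to f(n) ∑ g(k) h(-k), or
the same with f and g exchanged. Elsewhere the square is at most a constant times (1 + |p|)^{-1-s}
(1 + |q|)^{-1-s}, with s = 2δ', for one of eleven integer pairs (p, q) determined by (m, ξ)
(`exists_logWeight_le`), and each map to a pair is at most two-to-one (`freqPair_fiber`). In
logarithms these bounds are linear inequalities, a few for each sign pattern, that come from
factorizations of D and R. The exponent a > max(2α, 1/2) with γ < 1 - a encodes both conditions on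
γ.

Absolute convergence, and with it the formula for the time transform as a series of convolutions,
rests on a cruder bound at fixed n: the kernel is a sum of terms that each decay like the power -(1
- α) of one input frequency, and this power is square summable because α < 1/2. -/

namespace Boussinesq

/-! ### Linear inequalities between logarithms of frequencies -/

/-- The exponents used in the multilinear estimate: `a` dominates `2α`, `κ` is the room left in the
condition on `γ`, and `s` is twice the loss in the modulation exponent. -/
structure Exponents (a κ s : ℝ) : Prop where
  half_lt : 1 / 2 < a
  lt_one : a < 1
  pos : 0 < s
  le_kappa : 10 * s ≤ κ
  kappa_le : 10 * κ ≤ 1 - a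

section Tropical

-- The capitals stand for the logarithmic sizes of n (`N`), ζ (`Z`), ξ (`X`), η (`E`), m (`M`), n -
-- ξ (`P`), n - η (`Q`), of the inner resonance function (`D`) and of the full one (`R`); `l` stands
-- for log 2 and absorbs constant factors. The letters `p` and `m` in the names below record the
-- signs ε₁, ε₂, ε₃.
variable {a κ s l N Z X E M P Q D R : ℝ}

/-- The critical inequality: for κ = s = 0 and N = X = P it is an equality up to `l`. The larger of
`X` and `P` absorbs `N`, because 2 - 2a < 1; the smaller one is left with total exponent 1 - s + 2κ,
and this is at least 1 + s since κ ≥ s. -/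
theorem conv_log_le (h : Exponents a κ s) (hl : 0 ≤ l) (hX : 0 ≤ X) (hP : 0 ≤ P)
    (hN : N ≤ max X P + l) :
    (2 - 2 * a - 2 * κ) * N - (2 - 2 * a) * X - (1 - s) * P ≤ l - (1 + s) * min X P := by
  obtain ⟨h1, h2, h3, h4, h5⟩ := h
  have hg : 0 ≤ 2 - 2 * a - 2 * κ := by linarith
  have hl' := mul_nonneg (by linarith : 0 ≤ 1 - (2 - 2 * a - 2 * κ)) hl
  rcases le_total X P with hXP | hXP
  · rw [max_eq_right hXP] at hN
    rw [min_eq_left hXP]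
    nlinarith [mul_nonneg hg (sub_nonneg.2 hN), mul_nonneg (by linarith : 0 ≤ 2 * κ - 2 * s) hX,
      mul_nonneg (by linarith : 0 ≤ 1 - s - (2 - 2 * a - 2 * κ)) (sub_nonneg.2 hXP)]
  · rw [max_eq_left hXP] at hN
    rw [min_eq_right hXP]
    nlinarith [mul_nonneg hg (sub_nonneg.2 hN), mul_nonneg (by linarith : 0 ≤ 2 * κ - 2 * s) hP,
      mul_nonneg (by linarith : 0 ≤ 2 * κ) (sub_nonneg.2 hXP)]

/-- The resonance function is twice a sum of two products. In the `far` lemmas the product not tied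
to the first lower bound dominates and bounds R from below. In the `near` lemmas the two may cancel,
R has no lower bound, and R itself serves as a summation variable. -/
theorem log_ppp_far (h : Exponents a κ s) (hl : 0 ≤ l) (hN : 0 ≤ N) (hX : 0 ≤ X) (hE : 0 ≤ E)
    (hM : 0 ≤ M) (hNZM : N ≤ Z + M) (hD : X + E ≤ D + 5 * l) (hR : M + Z ≤ R + 5 * l) :
    (2 - 2 * a - 2 * κ) * N + a * (Z + X + E - N) - 2 * D - (1 - s) * R
      ≤ 100 * l - (1 + s) * (X + E) := by
  obtain ⟨h1, h2, h3, h4, h5⟩ := h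
  linarith [mul_nonneg (by linarith : 0 ≤ 1 - a - s) hX,
    mul_nonneg (by linarith : 0 ≤ 1 - a - s) hE,
    mul_nonneg (by linarith : 0 ≤ 1 - a - s) (sub_nonneg.2 hNZM),
    mul_nonneg (by linarith : 0 ≤ a) hM, mul_nonneg (by linarith : 0 ≤ 2 * a + 2 * κ - 1 - s) hN,
    mul_nonneg (by linarith : 0 ≤ 1 - s) (sub_nonneg.2 hR), mul_nonneg h3.le hl]

/-- The exponent 1 - s of the gain falls short of the 1 + s needed for summation in R. The missing
2s is taken from the inner denominator, which dominates ξη and hence R. -/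
theorem log_ppp_near (h : Exponents a κ s) (hl : 0 ≤ l) (hN : 0 ≤ N) (hZ : 0 ≤ Z)
    (hNZM : N ≤ Z + M) (hD : X + E ≤ D + 5 * l)
    (hXE : M + Z ≤ X + E + 5 * l) (hR : R ≤ X + E + 5 * l) :
    (2 - 2 * a - 2 * κ) * N + a * (Z + X + E - N) - 2 * D - (1 - s) * R
      ≤ 100 * l - (1 + s) * (M + R) := by
  obtain ⟨h1, h2, h3, h4, h5⟩ := h
  linarith [mul_nonneg (by linarith : 0 ≤ 2 * s) (sub_nonneg.2 hR),
    mul_nonneg (by linarith : 0 ≤ 2 - a - 2 * s) (sub_nonneg.2 hXE),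
    mul_nonneg (by linarith : 0 ≤ 1 - a - 3 * s) (sub_nonneg.2 hNZM),
    mul_nonneg (by linarith : 0 ≤ 1 - a + s) hZ,
    mul_nonneg (by linarith : 0 ≤ 2 * a + 2 * κ - 1 - 3 * s) hN,
    mul_nonneg (by linarith : 0 ≤ 1 - s) hl, mul_nonneg (by linarith : 0 ≤ a) hl]

/-- Bounding ζ by the product of the sizes of n, ξ and η splits the weight into a factor in (ξ, n -
ξ) and one in (η, n - η). The first takes the whole power of n, so the second is `conv_log_le` with
N = 0. -/
theorem log_ppm (h : Exponents a κ s) (hl : 0 ≤ l) (hX : 0 ≤ X) (hE : 0 ≤ E)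
    (hP : 0 ≤ P) (hQ : 0 ≤ Q) (hZ : Z ≤ N + X + E) (hNX : N ≤ max X P + l)
    (hD : X + E ≤ D + 5 * l) (hR : P + Q ≤ R + 5 * l) :
    (2 - 2 * a - 2 * κ) * N + a * (Z + X + E - N) - 2 * D - (1 - s) * R
      ≤ 100 * l - (1 + s) * (min X P + min E Q) := by
  have c1 := conv_log_le h hl hX hP hNX
  have c2 := conv_log_le (N := 0) h hl hE hQ (by positivity)
  obtain ⟨h1, h2, h3, h4, h5⟩ := h
  linarith [mul_nonneg (by linarith : 0 ≤ a) (sub_nonneg.2 hZ),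
    mul_nonneg (by linarith : 0 ≤ 1 - s) (sub_nonneg.2 hR), mul_nonneg h3.le hl]

/-- The power of n is moved to ζ and m. Since ζ = (n - ξ) - η, `conv_log_le` applies with `Z` in the
role of `N`. -/
theorem log_pmp (h : Exponents a κ s) (hl : 0 ≤ l) (hE : 0 ≤ E) (hM : 0 ≤ M)
    (hP : 0 ≤ P) (hZ : Z ≤ N + M) (hX : X ≤ M + E) (hNZM : N ≤ Z + M) (hZE : Z ≤ max E P + l)
    (hD : E + M ≤ D + 5 * l) (hR : M + P ≤ R + 5 * l) :
    (2 - 2 * a - 2 * κ) * N + a * (Z + X + E - N) - 2 * D - (1 - s) * R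
      ≤ 100 * l - (1 + s) * (M + min E P) := by
  have c1 := conv_log_le h hl hE hP hZE
  obtain ⟨h1, h2, h3, h4, h5⟩ := h
  linarith [mul_nonneg (by linarith : 0 ≤ a) (sub_nonneg.2 hZ),
    mul_nonneg (by linarith : 0 ≤ a) (sub_nonneg.2 hX),
    mul_nonneg (by linarith : 0 ≤ 2 - 2 * a - 2 * κ) (sub_nonneg.2 hNZM),
    mul_nonneg (by linarith : 0 ≤ 2 * κ - 2 * s) hM,
    mul_nonneg (by linarith : 0 ≤ 1 - s) (sub_nonneg.2 hR), mul_nonneg h3.le hl]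

theorem log_mmm (h : Exponents a κ s) (hl : 0 ≤ l) (hN : 0 ≤ N) (hX : 0 ≤ X) (hE : 0 ≤ E)
    (hD : X + E ≤ D + 5 * l) (hRN : 2 * N ≤ R + 5 * l) (hRZ : 2 * Z ≤ R + 5 * l) :
    (2 - 2 * a - 2 * κ) * N + a * (Z + X + E - N) - 2 * D - (1 - s) * R
      ≤ 100 * l - (1 + s) * (X + E) := by
  obtain ⟨h1, h2, h3, h4, h5⟩ := h
  linarith [mul_nonneg (by linarith : 0 ≤ 1 - a - s) hX,
    mul_nonneg (by linarith : 0 ≤ 1 - a - s) hE,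
    mul_nonneg (by linarith : 0 ≤ a / 2) (sub_nonneg.2 hRZ),
    mul_nonneg (by linarith : 0 ≤ 1 - a / 2 - s) (sub_nonneg.2 hRN),
    mul_nonneg (by linarith : 0 ≤ 2 * a + 2 * κ - 2 * s) hN,
    mul_nonneg (by linarith : 0 ≤ 1 - s) hl, mul_nonneg (by linarith : 0 ≤ 1 - a) hl,
    mul_nonneg h3.le hl]

theorem log_mmp_far (h : Exponents a κ s) (hl : 0 ≤ l) (hN : 0 ≤ N) (hX : 0 ≤ X) (hE : 0 ≤ E)
    (hM : 0 ≤ M) (hZ : Z ≤ N + M) (hD : X + E ≤ D + 5 * l) (hR : M + N ≤ R + 5 * l) :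
    (2 - 2 * a - 2 * κ) * N + a * (Z + X + E - N) - 2 * D - (1 - s) * R
      ≤ 100 * l - (1 + s) * (X + E) := by
  obtain ⟨h1, h2, h3, h4, h5⟩ := h
  linarith [mul_nonneg (by linarith : 0 ≤ 1 - a - s) hX,
    mul_nonneg (by linarith : 0 ≤ 1 - a - s) hE,
    mul_nonneg (by linarith : 0 ≤ a) (sub_nonneg.2 hZ),
    mul_nonneg (by linarith : 0 ≤ 1 - a - s) hM,
    mul_nonneg (by linarith : 0 ≤ 2 * a + 2 * κ - 1 - s) hN,
    mul_nonneg (by linarith : 0 ≤ 1 - s) (sub_nonneg.2 hR), mul_nonneg h3.le hl]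

/-- The inner resonance function is a sum of squares here and dominates ξη, mn, mζ and R
simultaneously. -/
theorem log_mmp_near (h : Exponents a κ s) (hl : 0 ≤ l) (hN : 0 ≤ N)
    (hM : 0 ≤ M) (hD : X + E ≤ D + 5 * l) (hDM : M + N ≤ D + 5 * l)
    (hDZ : Z + M ≤ D + 5 * l) (hR : R ≤ D + 5 * l) :
    (2 - 2 * a - 2 * κ) * N + a * (Z + X + E - N) - 2 * D - (1 - s) * R
      ≤ 100 * l - (1 + s) * (M + R) := by
  obtain ⟨h1, h2, h3, h4, h5⟩ := h
  linarith [mul_nonneg (by linarith : 0 ≤ a) (sub_nonneg.2 hD),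
    mul_nonneg (by linarith : 0 ≤ a) (sub_nonneg.2 hDZ),
    mul_nonneg (by linarith : 0 ≤ 2 * s) (sub_nonneg.2 hR),
    mul_nonneg (by linarith : 0 ≤ 2 - 2 * a - 2 * s) (sub_nonneg.2 hDM),
    mul_nonneg (by linarith : 0 ≤ a + 2 * κ - 2 * s) hN,
    mul_nonneg (by linarith : 0 ≤ 1 - a - 3 * s) hM,
    mul_nonneg (by linarith : 0 ≤ 1 - s) hl, mul_nonneg (by linarith : 0 ≤ 1 - a) hl]

theorem log_pmm_far (h : Exponents a κ s) (hl : 0 ≤ l) (hN : 0 ≤ N) (hZ₀ : 0 ≤ Z)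
    (hZ : Z ≤ N + M) (hX : X ≤ M + E)
    (hD : E + M ≤ D + 5 * l) (hEM : E + M ≤ Z + N + 5 * l) (hR : Z + N ≤ R + 5 * l) :
    (2 - 2 * a - 2 * κ) * N + a * (Z + X + E - N) - 2 * D - (1 - s) * R
      ≤ 100 * l - (1 + s) * (M + E) := by
  obtain ⟨h1, h2, h3, h4, h5⟩ := h
  linarith [mul_nonneg (by linarith : 0 ≤ a) (sub_nonneg.2 hX),
    mul_nonneg (by linarith : 0 ≤ 2 * a - 1 + s) (sub_nonneg.2 hEM),
    mul_nonneg (by linarith : 0 ≤ 1 - s) (sub_nonneg.2 hR),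
    mul_nonneg (by linarith : 0 ≤ a) (sub_nonneg.2 hZ),
    mul_nonneg (by linarith : 0 ≤ 2 - 2 * a - 2 * s) hZ₀,
    mul_nonneg (by linarith : 0 ≤ 2 * κ - 2 * s) hN,
    mul_nonneg (by linarith : 0 ≤ 1 - s) hl, mul_nonneg (by linarith : 0 ≤ 1 - a) hl]

theorem log_pmm_near (h : Exponents a κ s) (hl : 0 ≤ l) (hN : 0 ≤ N) (hM : 0 ≤ M) (hE : 0 ≤ E)
    (hNZM : N ≤ max Z M + l) (hZ : Z ≤ max N M + l) (hX : X ≤ max M E + l)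
    (hD : E + M ≤ D + 5 * l) (hZN : Z + N ≤ E + M + 5 * l) (hR : R ≤ E + M + 5 * l) :
    (2 - 2 * a - 2 * κ) * N + a * (Z + X + E - N) - 2 * D - (1 - s) * R
      ≤ 100 * l - (1 + s) * (M + R) ∨
    (2 - 2 * a - 2 * κ) * N + a * (Z + X + E - N) - 2 * D - (1 - s) * R
      ≤ 100 * l - (1 + s) * (E + R) := by
  obtain ⟨h1, h2, h3, h4, h5⟩ := h
  have h6 : 0 ≤ a := by linarith
  have k1 := mul_nonneg (by linarith : 0 ≤ 2 * s) (sub_nonneg.2 hR)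
  have k2 := mul_nonneg (by linarith : 0 ≤ 1 - s) hl
  have k3 := mul_nonneg (by linarith : 0 ≤ 1 - a) hl
  have k4 := mul_nonneg h3.le hl
  have k5 := mul_nonneg h6 hl
  -- If m is much smaller than n, then ζ is at least comparable to n, and |ζn| ≲ |ηm| forces η to be
  -- as well: 2N - l ≤ Z + N ≤ E + M + 5l together with M < N - 3l gives E > N - 3l.
  rcases lt_or_ge M (N - 3 * l) with hMN | hMN
  · left
    have hZ' : N - l ≤ Z := by
      rcases le_total Z M with hh | hh
      · rw [max_eq_right hh] at hNZM; linarith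
      · rw [max_eq_left hh] at hNZM; linarith
    rw [max_eq_left (by linarith)] at hZ
    rw [max_eq_right (by linarith)] at hX
    linarith [mul_nonneg h6 (sub_nonneg.2 hX), mul_nonneg h6 (sub_nonneg.2 hZ),
      mul_nonneg (by linarith : 0 ≤ 2 - 2 * a - 2 * s) (by linarith : 0 ≤ E - (N - 3 * l)),
      mul_nonneg (by linarith : 0 ≤ 2 * κ - 2 * s) hN,
      mul_nonneg (by linarith : 0 ≤ 1 - 3 * s) hM]
  · have hZ' : Z ≤ M + 4 * l := hZ.trans (by
      rcases le_total N M with hh | hh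
      · rw [max_eq_right hh]; linarith
      · rw [max_eq_left hh]; linarith)
    -- Now ζ is at most comparable to m, and the smaller of m and η is paired with R.
    rcases le_total M E with hME | hME
    · left
      rw [max_eq_right hME] at hX
      linarith [mul_nonneg h6 (sub_nonneg.2 hX), mul_nonneg h6 (sub_nonneg.2 hZ'),
        mul_nonneg (by linarith : 0 ≤ 2 - 2 * a - 2 * s) (sub_nonneg.2 hME),
        mul_nonneg (by linarith : 0 ≤ 3 - 3 * a - 5 * s) (by linarith : 0 ≤ M - (N - 3 * l)),
        mul_nonneg (by linarith : 0 ≤ 1 + 2 * κ - 5 * s) hN]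
    · right
      rw [max_eq_left hME] at hX
      linarith [mul_nonneg h6 (sub_nonneg.2 hX), mul_nonneg h6 (sub_nonneg.2 hZ'),
        mul_nonneg (by linarith : 0 ≤ 2 - 2 * a - 2 * s) (by linarith : 0 ≤ M - (N - 3 * l)),
        mul_nonneg (by linarith : 0 ≤ 1 - a - 3 * s) hE,
        mul_nonneg (by linarith : 0 ≤ a + 2 * κ - 2 * s) hN]

end Tropical

section Resonance

/-! ### Logarithms of integer frequencies -/

/-- The logarithmic size `log (1 + |k|)` of an integer frequency. -/
noncomputable def logJ (k : ℤ) : ℝ := Real.log (1 + |(k : ℝ)|)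

theorem logJ_nonneg (k : ℤ) : 0 ≤ logJ k := Real.log_nonneg (by linarith [abs_nonneg (k : ℝ)])

theorem exp_logJ (k : ℤ) : Real.exp (logJ k) = 1 + |(k : ℝ)| := Real.exp_log (by positivity)

theorem logJ_neg (k : ℤ) : logJ (-k) = logJ k := by simp [logJ]

theorem logJ_add_le (j k : ℤ) : logJ (j + k) ≤ logJ j + logJ k := by
  unfold logJ
  rw [← Real.log_mul (by positivity) (by positivity)]
  refine Real.log_le_log (by positivity) ?_
  push_cast
  nlinarith [abs_add_le (j : ℝ) k, mul_nonneg (abs_nonneg (j : ℝ)) (abs_nonneg (k : ℝ))]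

theorem logJ_le_of_abs_le {j k : ℤ} (i : ℕ) (h : |j| ≤ 2 ^ i * |k|) :
    logJ j ≤ logJ k + i * Real.log 2 := by
  unfold logJ
  rw [← Real.log_pow, ← Real.log_mul (by positivity) (by positivity)]
  refine Real.log_le_log (by positivity) ?_
  have h' : |(j : ℝ)| ≤ 2 ^ i * |(k : ℝ)| := by exact_mod_cast h
  have : (1 : ℝ) ≤ 2 ^ i := one_le_pow₀ (by norm_num)
  linarith

theorem logJ_add_le_max (j k : ℤ) : logJ (j + k) ≤ max (logJ j) (logJ k) + Real.log 2 := by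
  rcases le_total |j| |k| with h | h
  · refine (logJ_le_of_abs_le (k := k) 1 ?_).trans ?_
    · linarith [abs_add_le j k]
    · rw [Nat.cast_one, one_mul]; gcongr; exact le_max_right _ _
  · refine (logJ_le_of_abs_le (k := j) 1 ?_).trans ?_
    · linarith [abs_add_le j k]
    · rw [Nat.cast_one, one_mul]; gcongr; exact le_max_left _ _

theorem logJ_sub_le (j k : ℤ) : logJ (j - k) ≤ logJ j + logJ k := by
  rw [sub_eq_add_neg, ← logJ_neg k]
  exact logJ_add_le j (-k)

theorem logJ_sub_le_max (j k : ℤ) : logJ (j - k) ≤ max (logJ j) (logJ k) + Real.log 2 := by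
  rw [sub_eq_add_neg, ← logJ_neg k]
  exact logJ_add_le_max j (-k)

theorem logJ_mul_le (j k : ℤ) : logJ (j * k) ≤ logJ j + logJ k := by
  unfold logJ
  rw [← Real.log_mul (by positivity) (by positivity)]
  refine Real.log_le_log (by positivity) ?_
  push_cast
  rw [abs_mul]
  nlinarith [abs_nonneg (j : ℝ), abs_nonneg (k : ℝ)]

/-- For |j|, |k| ≥ 1 one has (1 + |j|)(1 + |k|) ≤ 4(1 + |jk|). This fails if a factor vanishes,
which is why the lower bounds for D and R need nonzero frequencies. -/
theorem le_logJ_mul {j k : ℤ} (hj : j ≠ 0) (hk : k ≠ 0) :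
    logJ j + logJ k ≤ logJ (j * k) + 2 * Real.log 2 := by
  unfold logJ
  rw [← Real.log_mul (by positivity) (by positivity),
    show (2 : ℝ) * Real.log 2 = ((2 : ℕ) : ℝ) * Real.log 2 by norm_num, ← Real.log_pow,
    ← Real.log_mul (by positivity) (by positivity)]
  refine Real.log_le_log (by positivity) ?_
  have hj' : (1 : ℝ) ≤ |(j : ℝ)| := by exact_mod_cast Int.one_le_abs hj
  have hk' : (1 : ℝ) ≤ |(k : ℝ)| := by exact_mod_cast Int.one_le_abs hk
  push_cast
  rw [abs_mul]
  nlinarith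

theorem logJ_le_of_abs_le_eight {c d : ℤ} (h : |c| ≤ 8 * |d|) :
    logJ c ≤ logJ d + 3 * Real.log 2 := by
  simpa using logJ_le_of_abs_le (j := c) (k := d) 3 (by norm_num; exact h)

theorem logJ_le_of_abs_le_mul {c j k : ℤ} (h : |c| ≤ 8 * |j * k|) :
    logJ c ≤ logJ j + logJ k + 5 * Real.log 2 := by
  have hl : 0 ≤ Real.log 2 := Real.log_nonneg (by norm_num)
  linarith [logJ_mul_le j k, logJ_le_of_abs_le_eight h]

theorem logJ_add_logJ_le {c j k : ℤ} (hj : j ≠ 0) (hk : k ≠ 0)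
    (h : |j * k| ≤ 8 * |c|) : logJ j + logJ k ≤ logJ c + 5 * Real.log 2 := by
  linarith [le_logJ_mul hj hk, logJ_le_of_abs_le_eight h]

theorem logJ_add_logJ_le_add {i c j k : ℤ} (hj : j ≠ 0) (hk : k ≠ 0)
    (h : |j * k| ≤ 8 * |i * c|) : logJ j + logJ k ≤ logJ i + logJ c + 5 * Real.log 2 := by
  linarith [le_logJ_mul hj hk, logJ_le_of_abs_le_eight h, logJ_mul_le i c]

/-- With its companion below, the dichotomy between the `far` and `near` cases, for R = 2(A + B). -/
theorem abs_le_abs_two_mul_add {A B : ℤ} (h : 2 * |A| ≤ |B|) : |B| ≤ |2 * (A + B)| := by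
  rcases abs_cases A with ⟨h1, _⟩ | ⟨h1, _⟩ <;> rcases abs_cases B with ⟨h2, _⟩ | ⟨h2, _⟩ <;>
    rcases abs_cases (2 * (A + B)) with ⟨h3, _⟩ | ⟨h3, _⟩ <;> omega

theorem abs_two_mul_add_le_abs {A B : ℤ} (h : |B| ≤ 2 * |A|) : |2 * (A + B)| ≤ 8 * |A| := by
  rcases abs_cases A with ⟨h1, _⟩ | ⟨h1, _⟩ <;> rcases abs_cases B with ⟨h2, _⟩ | ⟨h2, _⟩ <;>
    rcases abs_cases (2 * (A + B)) with ⟨h3, _⟩ | ⟨h3, _⟩ <;> omega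

theorem abs_le_eight_mul_abs {A B : ℤ} (h : |A| ≤ |B|) : |A| ≤ 8 * |B| := by
  linarith [abs_nonneg B]

/-! ### Resonance functions

The frequencies are parametrized by the output frequency `n` and by `x = (m, ξ)`: the three input
frequencies are `ξ`, `η = m - ξ` and `ζ = n - m`. -/

/-- The resonance function of the trilinear interaction. -/
def resonance (ε₁ ε₂ ε₃ : ℤˣ) (n : ℤ) (x : ℤ × ℤ) : ℤ :=
  n ^ 2 - ε₁ * x.2 ^ 2 - ε₂ * (x.1 - x.2) ^ 2 - ε₃ * (n - x.1) ^ 2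

/-- The resonance function of the bilinear interaction in the normal form operator. -/
def innerResonance (ε₁ ε₂ : ℤˣ) (ξ η : ℤ) : ℤ :=
  ε₁ * ξ ^ 2 + ε₂ * η ^ 2 - (ξ + η) ^ 2

/-- The pairs of integers in terms of which the nonresonant sums are estimated. -/
def freqPair (ε₁ ε₂ ε₃ : ℤˣ) (n : ℤ) (i : Fin 11) (x : ℤ × ℤ) : ℤ × ℤ :=
  -- Entries 0 to 7 are linear in (m, ξ); entries 8 to 10 contain the resonance function. Entries 5,
  -- 7 and 10 make the list stable under the exchange of ξ and η.
  ![(x.2, x.1 - x.2), (n - x.2, x.1 - x.2), (x.2, n - (x.1 - x.2)), (n - x.2, n - (x.1 - x.2)),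
    (x.1, x.1 - x.2), (x.1, x.2), (x.1, n - x.2), (x.1, n - (x.1 - x.2)),
    (x.1, resonance ε₁ ε₂ ε₃ n x), (x.1 - x.2, resonance ε₁ ε₂ ε₃ n x),
    (x.2, resonance ε₁ ε₂ ε₃ n x)] i

/-- The logarithm of (the square of) the multiplier in the trilinear estimate. -/
noncomputable def logWeight (a κ : ℝ) (ε₁ ε₂ : ℤˣ) (n : ℤ) (x : ℤ × ℤ) : ℝ :=
  (2 - 2 * a - 2 * κ) * logJ n + a * (logJ (n - x.1) + logJ x.2 + logJ (x.1 - x.2) - logJ n)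
    - 2 * logJ (innerResonance ε₁ ε₂ x.2 (x.1 - x.2))

/-- The frequencies that contribute to the output mode `n`. -/
structure Admissible (n : ℤ) (x : ℤ × ℤ) : Prop where
  n_ne : n ≠ 0
  m_ne : x.1 ≠ 0
  xi_ne : x.2 ≠ 0
  eta_ne : x.1 - x.2 ≠ 0
  zeta_ne : n - x.1 ≠ 0

/-- The frequencies for which neither of the first two inputs carries the output frequency. -/
structure Nonresonant (n : ℤ) (x : ℤ × ℤ) : Prop where
  m_ne : x.1 ≠ 0
  p_ne : n - x.2 ≠ 0
  q_ne : n - (x.1 - x.2) ≠ 0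

variable {a κ s : ℝ}


/-! ### Bounds for the multiplier, one sign pattern at a time -/

theorem logWeight_ppp (h : Exponents a κ s) {n : ℤ} {x : ℤ × ℤ} (hx : Admissible n x) :
    ∃ i, logWeight a κ 1 1 n x - (1 - s) * logJ (resonance 1 1 1 n x) ≤ 100 * Real.log 2
      - (1 + s) * (logJ (freqPair 1 1 1 n i x).1 + logJ (freqPair 1 1 1 n i x).2) := by
  obtain ⟨m, ξ⟩ := x
  obtain ⟨hn, hm, hξ, hη, hζ⟩ := hx
  dsimp only at *
  have hl : 0 ≤ Real.log 2 := Real.log_nonneg (by norm_num)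
  have hD : innerResonance 1 1 ξ (m - ξ) = -2 * (ξ * (m - ξ)) := by
    simp only [innerResonance, Units.val_one]; ring
  have hR : resonance 1 1 1 n (m, ξ) = 2 * (ξ * (m - ξ) + m * (n - m)) := by
    simp only [resonance, Units.val_one]; ring
  have hD' := logJ_add_logJ_le (c := innerResonance 1 1 ξ (m - ξ)) hξ hη (by
    rw [hD, abs_mul (-2), abs_neg, abs_two]; linarith [abs_nonneg (ξ * (m - ξ))])
  have hN : logJ n ≤ logJ (n - m) + logJ m := by simpa using logJ_add_le (n - m) m
  rcases le_total (2 * |ξ * (m - ξ)|) |m * (n - m)| with hc | hc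
  · exact ⟨0, log_ppp_far h hl (logJ_nonneg _) (logJ_nonneg _) (logJ_nonneg _) (logJ_nonneg _)
      hN hD' (logJ_add_logJ_le hm hζ
        (abs_le_eight_mul_abs (by rw [hR]; exact abs_le_abs_two_mul_add hc)))⟩
  · exact ⟨8, log_ppp_near h hl (logJ_nonneg _) (logJ_nonneg _) hN hD'
      (logJ_add_logJ_le_add hm hζ (hc.trans (by linarith [abs_nonneg (ξ * (m - ξ))])))
      (logJ_le_of_abs_le_mul (by rw [hR]; exact abs_two_mul_add_le_abs hc))⟩

theorem logWeight_ppm (h : Exponents a κ s) {n : ℤ} {x : ℤ × ℤ} (hx : Admissible n x)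
    (hx' : Nonresonant n x) :
    ∃ i, logWeight a κ 1 1 n x - (1 - s) * logJ (resonance 1 1 (-1) n x) ≤ 100 * Real.log 2
      - (1 + s) * (logJ (freqPair 1 1 (-1) n i x).1 + logJ (freqPair 1 1 (-1) n i x).2) := by
  obtain ⟨m, ξ⟩ := x
  obtain ⟨hn, hm, hξ, hη, hζ⟩ := hx
  obtain ⟨-, hp, hq⟩ := hx'
  dsimp only at *
  have hl : 0 ≤ Real.log 2 := Real.log_nonneg (by norm_num)
  have hD : innerResonance 1 1 ξ (m - ξ) = -2 * (ξ * (m - ξ)) := by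
    simp only [innerResonance, Units.val_one]; ring
  have hR : resonance 1 1 (-1) n (m, ξ) = 2 * ((n - ξ) * (n - (m - ξ))) := by
    simp only [resonance, Units.val_one, Units.val_neg]; ring
  have hD' := logJ_add_logJ_le (c := innerResonance 1 1 ξ (m - ξ)) hξ hη (by
    rw [hD, abs_mul (-2), abs_neg, abs_two]; linarith [abs_nonneg (ξ * (m - ξ))])
  have hR' := logJ_add_logJ_le (c := resonance 1 1 (-1) n (m, ξ)) hp hq (by
    rw [hR, abs_mul 2, abs_two]; linarith [abs_nonneg ((n - ξ) * (n - (m - ξ)))])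
  have hZ : logJ (n - m) ≤ logJ n + logJ ξ + logJ (m - ξ) := by
    have h1 := logJ_sub_le n m
    have h2 := logJ_add_le ξ (m - ξ)
    rw [add_sub_cancel] at h2
    linarith
  have hN : logJ n ≤ max (logJ ξ) (logJ (n - ξ)) + Real.log 2 := by
    simpa using logJ_add_le_max ξ (n - ξ)
  have key := log_ppm h hl (logJ_nonneg _) (logJ_nonneg _) (logJ_nonneg _) (logJ_nonneg _)
    hZ hN hD' hR'
  rcases min_choice (logJ ξ) (logJ (n - ξ)) with e1 | e1 <;>
    rcases min_choice (logJ (m - ξ)) (logJ (n - (m - ξ))) with e2 | e2 <;> rw [e1, e2] at key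
  exacts [⟨0, key⟩, ⟨2, key⟩, ⟨1, key⟩, ⟨3, key⟩]

theorem logWeight_pmp (h : Exponents a κ s) {n : ℤ} {x : ℤ × ℤ} (hx : Admissible n x)
    (hx' : Nonresonant n x) :
    ∃ i, logWeight a κ 1 (-1) n x - (1 - s) * logJ (resonance 1 (-1) 1 n x) ≤ 100 * Real.log 2
      - (1 + s) * (logJ (freqPair 1 (-1) 1 n i x).1 + logJ (freqPair 1 (-1) 1 n i x).2) := by
  obtain ⟨m, ξ⟩ := x
  obtain ⟨hn, hm, hξ, hη, hζ⟩ := hx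
  obtain ⟨-, hp, hq⟩ := hx'
  dsimp only at *
  have hl : 0 ≤ Real.log 2 := Real.log_nonneg (by norm_num)
  have hD : innerResonance 1 (-1) ξ (m - ξ) = -2 * ((m - ξ) * m) := by
    simp only [innerResonance, Units.val_one, Units.val_neg]; ring
  have hR : resonance 1 (-1) 1 n (m, ξ) = 2 * (m * (n - ξ)) := by
    simp only [resonance, Units.val_one, Units.val_neg]; ring
  have hD' := logJ_add_logJ_le (c := innerResonance 1 (-1) ξ (m - ξ)) hη hm (by
    rw [hD, abs_mul (-2), abs_neg, abs_two]; linarith [abs_nonneg ((m - ξ) * m)])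
  have hR' := logJ_add_logJ_le (c := resonance 1 (-1) 1 n (m, ξ)) hm hp (by
    rw [hR, abs_mul 2, abs_two]; linarith [abs_nonneg (m * (n - ξ))])
  have hZ : logJ (n - m) ≤ logJ n + logJ m := logJ_sub_le n m
  have hX : logJ ξ ≤ logJ m + logJ (m - ξ) := by
    simpa using logJ_sub_le m (m - ξ)
  have hN : logJ n ≤ logJ (n - m) + logJ m := by simpa using logJ_add_le (n - m) m
  have hZE : logJ (n - m) ≤ max (logJ (m - ξ)) (logJ (n - ξ)) + Real.log 2 := by
    have h1 := logJ_add_le_max (-(m - ξ)) (n - ξ)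
    rw [logJ_neg, show -(m - ξ) + (n - ξ) = n - m by ring] at h1
    exact h1
  have key := log_pmp h hl (logJ_nonneg _) (logJ_nonneg _) (logJ_nonneg _)
    hZ hX hN hZE hD' hR'
  rcases min_choice (logJ (m - ξ)) (logJ (n - ξ)) with e2 | e2 <;> rw [e2] at key
  exacts [⟨4, key⟩, ⟨6, key⟩]

theorem logWeight_pmm (h : Exponents a κ s) {n : ℤ} {x : ℤ × ℤ} (hx : Admissible n x) :
    ∃ i, logWeight a κ 1 (-1) n x - (1 - s) * logJ (resonance 1 (-1) (-1) n x) ≤ 100 * Real.log 2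
      - (1 + s) * (logJ (freqPair 1 (-1) (-1) n i x).1
        + logJ (freqPair 1 (-1) (-1) n i x).2) := by
  obtain ⟨m, ξ⟩ := x
  obtain ⟨hn, hm, hξ, hη, hζ⟩ := hx
  dsimp only at *
  have hl : 0 ≤ Real.log 2 := Real.log_nonneg (by norm_num)
  have hD : innerResonance 1 (-1) ξ (m - ξ) = -2 * ((m - ξ) * m) := by
    simp only [innerResonance, Units.val_one, Units.val_neg]; ring
  have hR : resonance 1 (-1) (-1) n (m, ξ) = 2 * ((m - ξ) * m + (n - m) * n) := by
    simp only [resonance, Units.val_one, Units.val_neg]; ring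
  have hD' := logJ_add_logJ_le (c := innerResonance 1 (-1) ξ (m - ξ)) hη hm (by
    rw [hD, abs_mul (-2), abs_neg, abs_two]; linarith [abs_nonneg ((m - ξ) * m)])
  have hZ : logJ (n - m) ≤ logJ n + logJ m := logJ_sub_le n m
  have hX : logJ ξ ≤ logJ m + logJ (m - ξ) := by
    simpa using logJ_sub_le m (m - ξ)
  rcases le_total (2 * |(m - ξ) * m|) |(n - m) * n| with hc | hc
  · have hEM := logJ_add_logJ_le_add (i := n - m) (c := n) hη hm (by
      linarith [abs_nonneg ((m - ξ) * m), abs_nonneg ((n - m) * n)])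
    exact ⟨4, log_pmm_far h hl (logJ_nonneg _) (logJ_nonneg _) hZ hX hD' hEM
      (logJ_add_logJ_le hζ hn
        (abs_le_eight_mul_abs (by rw [hR]; exact abs_le_abs_two_mul_add hc)))⟩
  · have key := log_pmm_near h hl (logJ_nonneg n) (logJ_nonneg m) (logJ_nonneg (m - ξ))
      (by simpa using logJ_add_le_max (n - m) m)
      (logJ_sub_le_max n m)
      (by simpa using logJ_sub_le_max m (m - ξ)) hD'
      (logJ_add_logJ_le_add hζ hn (hc.trans (by linarith [abs_nonneg ((m - ξ) * m)])))
      (logJ_le_of_abs_le_mul (c := resonance 1 (-1) (-1) n (m, ξ))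
        (by rw [hR]; exact abs_two_mul_add_le_abs hc))
    rcases key with key | key
    exacts [⟨8, key⟩, ⟨9, key⟩]

theorem logWeight_mmp (h : Exponents a κ s) {n : ℤ} {x : ℤ × ℤ} (hx : Admissible n x) :
    ∃ i, logWeight a κ (-1) (-1) n x - (1 - s) * logJ (resonance (-1) (-1) 1 n x)
      ≤ 100 * Real.log 2 - (1 + s) * (logJ (freqPair (-1) (-1) 1 n i x).1
        + logJ (freqPair (-1) (-1) 1 n i x).2) := by
  obtain ⟨m, ξ⟩ := x
  obtain ⟨hn, hm, hξ, hη, hζ⟩ := hx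
  dsimp only at *
  have hl : 0 ≤ Real.log 2 := Real.log_nonneg (by norm_num)
  have hD : |innerResonance (-1) (-1) ξ (m - ξ)| = ξ ^ 2 + (m - ξ) ^ 2 + m ^ 2 := by
    rw [← abs_neg, ← abs_of_nonneg (by positivity : 0 ≤ ξ ^ 2 + (m - ξ) ^ 2 + m ^ 2)]
    simp only [innerResonance, Units.val_one, Units.val_neg]; ring_nf
  have hR : resonance (-1) (-1) 1 n (m, ξ) = 2 * (-(ξ * (m - ξ)) + m * n) := by
    simp only [resonance, Units.val_one, Units.val_neg]; ring
  have hA : 2 * |ξ * (m - ξ)| ≤ |innerResonance (-1) (-1) ξ (m - ξ)| := by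
    rw [hD, abs_mul]
    nlinarith [sq_nonneg (|ξ| - |m - ξ|), sq_abs ξ, sq_abs (m - ξ), sq_nonneg m]
  have hD' := logJ_add_logJ_le (c := innerResonance (-1) (-1) ξ (m - ξ)) hξ hη
    (by linarith [abs_nonneg (ξ * (m - ξ))])
  have hZ : logJ (n - m) ≤ logJ n + logJ m := logJ_sub_le n m
  rcases le_total (2 * |-(ξ * (m - ξ))|) |m * n| with hc | hc
  · exact ⟨0, log_mmp_far h hl (logJ_nonneg _) (logJ_nonneg _) (logJ_nonneg _) (logJ_nonneg _)
      hZ hD' (logJ_add_logJ_le hm hn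
        (abs_le_eight_mul_abs (by rw [hR]; exact abs_le_abs_two_mul_add hc)))⟩
  · have hc' := hc
    rw [abs_neg] at hc'
    have hM : m ^ 2 ≤ |innerResonance (-1) (-1) ξ (m - ξ)| := by
      rw [hD]; nlinarith [sq_nonneg ξ, sq_nonneg (m - ξ)]
    have hmm : |m * m| = m ^ 2 := by rw [abs_mul_self, sq]
    have hnm : |(n - m) * m| ≤ |m * n| + |m * m| := by
      rw [show (n - m) * m = m * n - m * m by ring]; exact abs_sub _ _
    have hR3 : logJ (resonance (-1) (-1) 1 n (m, ξ)) ≤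
        logJ (innerResonance (-1) (-1) ξ (m - ξ)) + 5 * Real.log 2 := by
      have h1 := abs_two_mul_add_le_abs hc
      rw [abs_neg, ← hR] at h1
      linarith [logJ_le_of_abs_le_eight (h1.trans
        (by linarith [abs_nonneg (ξ * (m - ξ))] :
          _ ≤ 8 * |innerResonance (-1) (-1) ξ (m - ξ)|))]
    have hMN := logJ_add_logJ_le (c := innerResonance (-1) (-1) ξ (m - ξ)) hm hn
      (by linarith [abs_nonneg (ξ * (m - ξ))])
    have hZM := logJ_add_logJ_le (c := innerResonance (-1) (-1) ξ (m - ξ)) hζ hm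
      (by linarith [abs_nonneg (ξ * (m - ξ))])
    exact ⟨8, log_mmp_near h hl (logJ_nonneg _) (logJ_nonneg _) hD' hMN hZM hR3⟩

theorem logWeight_mmm (h : Exponents a κ s) {n : ℤ} {x : ℤ × ℤ} (hx : Admissible n x) :
    ∃ i, logWeight a κ (-1) (-1) n x - (1 - s) * logJ (resonance (-1) (-1) (-1) n x)
      ≤ 100 * Real.log 2 - (1 + s) * (logJ (freqPair (-1) (-1) (-1) n i x).1
        + logJ (freqPair (-1) (-1) (-1) n i x).2) := by
  obtain ⟨m, ξ⟩ := x
  obtain ⟨hn, hm, hξ, hη, hζ⟩ := hx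
  dsimp only at *
  have hl : 0 ≤ Real.log 2 := Real.log_nonneg (by norm_num)
  have hD : |innerResonance (-1) (-1) ξ (m - ξ)| = ξ ^ 2 + (m - ξ) ^ 2 + m ^ 2 := by
    rw [← abs_neg, ← abs_of_nonneg (by positivity : 0 ≤ ξ ^ 2 + (m - ξ) ^ 2 + m ^ 2)]
    simp only [innerResonance, Units.val_one, Units.val_neg]; ring_nf
  have hR : |resonance (-1) (-1) (-1) n (m, ξ)| = n ^ 2 + ξ ^ 2 + (m - ξ) ^ 2 + (n - m) ^ 2 := by
    rw [← abs_of_nonneg (by positivity : 0 ≤ n ^ 2 + ξ ^ 2 + (m - ξ) ^ 2 + (n - m) ^ 2)]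
    simp only [resonance, Units.val_one, Units.val_neg]; ring_nf
  have hA : 2 * |ξ * (m - ξ)| ≤ |innerResonance (-1) (-1) ξ (m - ξ)| := by
    rw [hD, abs_mul]
    nlinarith [sq_nonneg (|ξ| - |m - ξ|), sq_abs ξ, sq_abs (m - ξ), sq_nonneg m]
  have hD' := logJ_add_logJ_le (c := innerResonance (-1) (-1) ξ (m - ξ)) hξ hη
    (by linarith [abs_nonneg (ξ * (m - ξ))])
  have hRN := logJ_add_logJ_le (c := resonance (-1) (-1) (-1) n (m, ξ)) hn hn (by
    rw [hR, abs_mul_self]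
    nlinarith [sq_nonneg n, sq_nonneg ξ, sq_nonneg (m - ξ), sq_nonneg (n - m)])
  have hRZ := logJ_add_logJ_le (c := resonance (-1) (-1) (-1) n (m, ξ)) hζ hζ (by
    rw [hR, abs_mul_self]
    nlinarith [sq_nonneg n, sq_nonneg ξ, sq_nonneg (m - ξ), sq_nonneg (n - m)])
  exact ⟨0, log_mmm h hl (logJ_nonneg _) (logJ_nonneg _) (logJ_nonneg _) hD'
    (by linarith) (by linarith)⟩

/-- The symmetry between the first two inputs: it reduces the signs (-, +, ±) to (+, -, ±). -/
theorem logWeight_swap (ε₁ ε₂ : ℤˣ) (n m ξ : ℤ) :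
    logWeight a κ ε₂ ε₁ n (m, m - ξ) = logWeight a κ ε₁ ε₂ n (m, ξ) := by
  have : innerResonance ε₂ ε₁ (m - ξ) ξ = innerResonance ε₁ ε₂ ξ (m - ξ) := by
    simp only [innerResonance]; ring
  simp only [logWeight, sub_sub_cancel, this]
  ring

theorem resonance_swap (ε₁ ε₂ ε₃ : ℤˣ) (n m ξ : ℤ) :
    resonance ε₂ ε₁ ε₃ n (m, m - ξ) = resonance ε₁ ε₂ ε₃ n (m, ξ) := by
  simp only [resonance, sub_sub_cancel]; ring

theorem exists_freqPair_swap (ε₁ ε₂ ε₃ : ℤˣ) (n m ξ : ℤ) (i : Fin 11) :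
    ∃ j, logJ (freqPair ε₂ ε₁ ε₃ n i (m, m - ξ)).1 + logJ (freqPair ε₂ ε₁ ε₃ n i (m, m - ξ)).2 =
      logJ (freqPair ε₁ ε₂ ε₃ n j (m, ξ)).1 + logJ (freqPair ε₁ ε₂ ε₃ n j (m, ξ)).2 := by
  refine ⟨![0, 2, 1, 3, 5, 4, 7, 6, 8, 10, 9] i, ?_⟩
  fin_cases i <;> simp [freqPair, resonance_swap, add_comm]

/-- The bound for the nonresonant part of the trilinear multiplier. -/
theorem exists_logWeight_le (h : Exponents a κ s) (ε₁ ε₂ ε₃ : ℤˣ) {n : ℤ} {x : ℤ × ℤ}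
    (hx : Admissible n x) (hx' : Nonresonant n x) :
    ∃ i, logWeight a κ ε₁ ε₂ n x - (1 - s) * logJ (resonance ε₁ ε₂ ε₃ n x) ≤ 100 * Real.log 2
      - (1 + s) * (logJ (freqPair ε₁ ε₂ ε₃ n i x).1 + logJ (freqPair ε₁ ε₂ ε₃ n i x).2) := by
  have swapped : ∀ ε₃ : ℤˣ,
      (∃ i, logWeight a κ 1 (-1) n (x.1, x.1 - x.2) - (1 - s) *
        logJ (resonance 1 (-1) ε₃ n (x.1, x.1 - x.2)) ≤ 100 * Real.log 2
        - (1 + s) * (logJ (freqPair 1 (-1) ε₃ n i (x.1, x.1 - x.2)).1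
          + logJ (freqPair 1 (-1) ε₃ n i (x.1, x.1 - x.2)).2)) →
      ∃ i, logWeight a κ (-1) 1 n x - (1 - s) * logJ (resonance (-1) 1 ε₃ n x) ≤ 100 * Real.log 2
        - (1 + s) * (logJ (freqPair (-1) 1 ε₃ n i x).1 + logJ (freqPair (-1) 1 ε₃ n i x).2) := by
    rintro ε₃ ⟨i, hi⟩
    obtain ⟨j, hj⟩ := exists_freqPair_swap (-1) 1 ε₃ n x.1 x.2 i
    rw [logWeight_swap, resonance_swap, hj] at hi
    exact ⟨j, hi⟩
  have hs : Admissible n (x.1, x.1 - x.2) :=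
    ⟨hx.n_ne, hx.m_ne, hx.eta_ne, by simpa using hx.xi_ne, hx.zeta_ne⟩
  have hs' : Nonresonant n (x.1, x.1 - x.2) := ⟨hx'.m_ne, hx'.q_ne, by simpa using hx'.p_ne⟩
  rcases Int.units_eq_one_or ε₁ with rfl | rfl <;> rcases Int.units_eq_one_or ε₂ with rfl | rfl <;>
    rcases Int.units_eq_one_or ε₃ with rfl | rfl
  · exact logWeight_ppp h hx
  · exact logWeight_ppm h hx hx'
  · exact logWeight_pmp h hx hx'
  · exact logWeight_pmm h hx
  · exact swapped _ (logWeight_pmp h hs hs')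
  · exact swapped _ (logWeight_pmm h hs)
  · exact logWeight_mmp h hx
  · exact logWeight_mmm h hx

/-- Lower bounds for the resonance function of the normal form operator. -/
theorem logJ_innerResonance (ε₁ ε₂ : ℤˣ) {ξ η : ℤ} (hξ : ξ ≠ 0) (hη : η ≠ 0) (hm : ξ + η ≠ 0) :
    logJ ξ + logJ η ≤ logJ (innerResonance ε₁ ε₂ ξ η) + 5 * Real.log 2 ∨
      logJ η + logJ (ξ + η) ≤ logJ (innerResonance ε₁ ε₂ ξ η) + 5 * Real.log 2 ∨
      logJ ξ + logJ (ξ + η) ≤ logJ (innerResonance ε₁ ε₂ ξ η) + 5 * Real.log 2 := by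
  rcases Int.units_eq_one_or ε₁ with rfl | rfl <;> rcases Int.units_eq_one_or ε₂ with rfl | rfl
  · refine Or.inl (logJ_add_logJ_le hξ hη (abs_le_eight_mul_abs ?_))
    rw [show innerResonance 1 1 ξ η = -2 * (ξ * η) by
      simp only [innerResonance, Units.val_one]; ring, abs_mul (-2), abs_neg, abs_two]
    linarith [abs_nonneg (ξ * η)]
  · refine Or.inr (Or.inl (logJ_add_logJ_le hη hm (abs_le_eight_mul_abs ?_)))
    rw [show innerResonance 1 (-1) ξ η = -2 * (η * (ξ + η)) by
      simp only [innerResonance, Units.val_one, Units.val_neg]; ring, abs_mul (-2), abs_neg,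
      abs_two]
    linarith [abs_nonneg (η * (ξ + η))]
  · refine Or.inr (Or.inr (logJ_add_logJ_le hξ hm (abs_le_eight_mul_abs ?_)))
    rw [show innerResonance (-1) 1 ξ η = -2 * (ξ * (ξ + η)) by
      simp only [innerResonance, Units.val_one, Units.val_neg]; ring, abs_mul (-2), abs_neg,
      abs_two]
    linarith [abs_nonneg (ξ * (ξ + η))]
  · refine Or.inl (logJ_add_logJ_le hξ hη (abs_le_eight_mul_abs ?_))
    rw [← abs_neg (innerResonance _ _ _ _), show -innerResonance (-1) (-1) ξ η =
      ξ ^ 2 + η ^ 2 + (ξ + η) ^ 2 by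
      simp only [innerResonance, Units.val_one, Units.val_neg]; ring,
      abs_of_nonneg (by positivity : 0 ≤ ξ ^ 2 + η ^ 2 + (ξ + η) ^ 2), abs_mul]
    nlinarith [sq_nonneg (|ξ| - |η|), sq_abs ξ, sq_abs η, sq_nonneg (ξ + η)]

theorem two_le_abs_innerResonance (ε₁ ε₂ : ℤˣ) {ξ η : ℤ} (hξ : ξ ≠ 0) (hη : η ≠ 0)
    (hm : ξ + η ≠ 0) : 2 ≤ |innerResonance ε₁ ε₂ ξ η| := by
  have h1 := Int.one_le_abs (mul_ne_zero hξ hη)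
  have h2 := Int.one_le_abs (mul_ne_zero hη hm)
  have h3 := Int.one_le_abs (mul_ne_zero hξ hm)
  rcases Int.units_eq_one_or ε₁ with rfl | rfl <;> rcases Int.units_eq_one_or ε₂ with rfl | rfl
  · rw [show innerResonance 1 1 ξ η = -2 * (ξ * η) by
      simp only [innerResonance, Units.val_one]; ring, abs_mul (-2), abs_neg, abs_two]
    linarith
  · rw [show innerResonance 1 (-1) ξ η = -2 * (η * (ξ + η)) by
      simp only [innerResonance, Units.val_one, Units.val_neg]; ring, abs_mul (-2), abs_neg,
      abs_two]
    linarith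
  · rw [show innerResonance (-1) 1 ξ η = -2 * (ξ * (ξ + η)) by
      simp only [innerResonance, Units.val_one, Units.val_neg]; ring, abs_mul (-2), abs_neg,
      abs_two]
    linarith
  · rw [← abs_neg (innerResonance _ _ _ _), show -innerResonance (-1) (-1) ξ η =
      ξ ^ 2 + η ^ 2 + (ξ + η) ^ 2 by
      simp only [innerResonance, Units.val_one, Units.val_neg]; ring,
      abs_of_nonneg (by positivity : 0 ≤ ξ ^ 2 + η ^ 2 + (ξ + η) ^ 2)]
    have : 0 < ξ ^ 2 := by positivity
    have : 0 < η ^ 2 := by positivity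
    nlinarith [sq_nonneg (ξ + η)]

/-- The bound for the multiplier if the first input carries the output frequency. -/
theorem logWeight_le_of_eq (h : Exponents a κ s) (ε₁ ε₂ : ℤˣ) {n : ℤ} {x : ℤ × ℤ}
    (hx : Admissible n x) (hp : n = x.2) : logWeight a κ ε₁ ε₂ n x ≤ 100 * Real.log 2 := by
  obtain ⟨m, ξ⟩ := x
  obtain ⟨hn, hm, hξ, hη, hζ⟩ := hx
  dsimp only at *
  subst hp
  have hl : 0 ≤ Real.log 2 := Real.log_nonneg (by norm_num)
  -- For ξ = n the other two inputs are opposite, ζ = -η, and the weight becomes (2 - 2a - 2κ)N +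
  -- 2aZ - 2D. Each of the three lower bounds for D makes this bounded without any help from R.
  have hE : logJ (m - n) = logJ (n - m) := by rw [← logJ_neg, neg_sub]
  have hZ : logJ (n - m) ≤ logJ n + logJ m := logJ_sub_le n m
  have hN : logJ n ≤ logJ (n - m) + logJ m := by simpa using logJ_add_le (n - m) m
  have n1 := logJ_nonneg n
  have n2 := logJ_nonneg m
  have n3 := logJ_nonneg (n - m)
  have hD := logJ_innerResonance ε₁ ε₂ hξ hη (by simpa using hm)
  rw [hE, add_sub_cancel] at hD
  obtain ⟨h1, h2, h3, h4, h5⟩ := h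
  unfold logWeight
  dsimp only
  rw [hE]
  rcases hD with hD | hD | hD
  · nlinarith [mul_nonneg (by linarith : 0 ≤ a + κ) n1, mul_nonneg (by linarith : 0 ≤ 1 - a) n3]
  · nlinarith [mul_nonneg (by linarith : 0 ≤ 1 - a) (sub_nonneg.2 hN),
      mul_nonneg (by linarith : 0 ≤ a) n2, mul_nonneg (by linarith : 0 ≤ κ) n1]
  · nlinarith [mul_nonneg (by linarith : 0 ≤ a) (sub_nonneg.2 hZ),
      mul_nonneg (by linarith : 0 ≤ 1 - a) n2, mul_nonneg (by linarith : 0 ≤ κ) n1]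

/-- The bound for the multiplier if the second input carries the output frequency. -/
theorem logWeight_le_of_eq_sub (h : Exponents a κ s) (ε₁ ε₂ : ℤˣ) {n : ℤ} {x : ℤ × ℤ}
    (hx : Admissible n x) (hq : n = x.1 - x.2) : logWeight a κ ε₁ ε₂ n x ≤ 100 * Real.log 2 := by
  rw [← logWeight_swap ε₁ ε₂ n x.1 x.2]
  exact logWeight_le_of_eq h ε₂ ε₁
    ⟨hx.n_ne, hx.m_ne, hx.eta_ne, by simpa using hx.xi_ne, hx.zeta_ne⟩ hq

end Resonance

/-! ### Bounds for the symbols -/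

theorem bracket_pos (x : ℝ) : 0 < bracket x := Real.sqrt_pos.2 (by positivity)

theorem one_le_bracket (x : ℝ) : 1 ≤ bracket x := Real.one_le_sqrt.2 (by nlinarith)

theorem abs_le_bracket (x : ℝ) : |x| ≤ bracket x :=
  Real.abs_le_sqrt (by linarith)

theorem bracket_le (x : ℝ) : bracket x ≤ 1 + |x| :=
  Real.sqrt_le_iff.2 ⟨by positivity, by nlinarith [abs_nonneg x, sq_abs x]⟩

theorem one_add_abs_le (x : ℝ) : 1 + |x| ≤ 2 * bracket x := by
  linarith [one_le_bracket x, abs_le_bracket x]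

theorem sq_le_abs_mul_bracket (x : ℝ) : x ^ 2 ≤ |x| * bracket x := by
  nlinarith [abs_le_bracket x, abs_nonneg x, sq_abs x]

theorem abs_mul_bracket_le (x : ℝ) : |x| * bracket x ≤ x ^ 2 + 1 / 2 := by
  have : bracket x ^ 2 = 1 + x ^ 2 := Real.sq_sqrt (by positivity)
  nlinarith [sq_nonneg (|x| - bracket x), sq_abs x]

theorem bracket_rpow_le (k : ℤ) {r : ℝ} (hr : 0 ≤ r) : bracket k ^ r ≤ Real.exp (r * logJ k) := by
  rw [mul_comm, Real.exp_mul, exp_logJ]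
  exact Real.rpow_le_rpow (bracket_pos _).le (bracket_le _) hr

theorem bracket_rpow_neg_le (k : ℤ) {r : ℝ} (hr : 0 ≤ r) (hr' : r ≤ 1) :
    bracket k ^ (-r) ≤ 2 * Real.exp (-(r * logJ k)) := by
  have h1 : Real.exp (r * logJ k) ≤ 2 * bracket k ^ r := by
    rw [mul_comm r, Real.exp_mul, exp_logJ]
    calc (1 + |(k : ℝ)|) ^ r ≤ (2 * bracket k) ^ r :=
          Real.rpow_le_rpow (by positivity) (one_add_abs_le _) hr
      _ = 2 ^ r * bracket k ^ r := Real.mul_rpow (by norm_num) (bracket_pos _).le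
      _ ≤ 2 * bracket k ^ r := by
          gcongr
          · exact Real.rpow_nonneg (bracket_pos _).le _
          · exact (Real.rpow_le_rpow_of_exponent_le (by norm_num) hr').trans_eq (Real.rpow_one 2)
  rw [Real.rpow_neg (bracket_pos _).le, Real.exp_neg]
  have h2 : 0 < bracket (k : ℝ) ^ r := Real.rpow_pos_of_pos (bracket_pos _) _
  rw [inv_eq_one_div, inv_eq_one_div, mul_one_div, div_le_div_iff₀ h2 (Real.exp_pos _)]
  linarith

/-- Replacing |x|⟨x⟩ by x² changes each of the three terms by at most 1/2, so the denominator
differs from the integer D by at most 3/2. As |D| ≥ 2, it cannot vanish: |D| - 3/2 ≥ (1 + |D|)/8. -/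
theorem abs_normalForm_denominator_ge (ε₁ ε₂ : ℤˣ) {ξ η : ℤ} (hξ : ξ ≠ 0) (hη : η ≠ 0)
    (hm : ξ + η ≠ 0) :
    (1 + |(innerResonance ε₁ ε₂ ξ η : ℝ)|) / 8 ≤
      |((ε₁ : ℤ) : ℝ) * (|(ξ : ℝ)| * bracket ξ) + ((ε₂ : ℤ) : ℝ) * (|(η : ℝ)| * bracket η)
          - (((1 : ℤˣ) : ℤ) : ℝ) * (|(ξ + η : ℝ)| * bracket (ξ + η))| := by
  have h2 : (2 : ℝ) ≤ |(innerResonance ε₁ ε₂ ξ η : ℝ)| := by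
    exact_mod_cast two_le_abs_innerResonance ε₁ ε₂ hξ hη hm
  have a1 := sq_le_abs_mul_bracket (ξ : ℝ)
  have a2 := abs_mul_bracket_le (ξ : ℝ)
  have b1 := sq_le_abs_mul_bracket (η : ℝ)
  have b2 := abs_mul_bracket_le (η : ℝ)
  have c1 := sq_le_abs_mul_bracket (ξ + η : ℝ)
  have c2 := abs_mul_bracket_le (ξ + η : ℝ)
  set A := |(ξ : ℝ)| * bracket ξ
  set B := |(η : ℝ)| * bracket η
  set C := |(ξ + η : ℝ)| * bracket (ξ + η)
  have hdiff : |(((ε₁ : ℤ) : ℝ) * A + ((ε₂ : ℤ) : ℝ) * B - (((1 : ℤˣ) : ℤ) : ℝ) * C)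
      - (innerResonance ε₁ ε₂ ξ η : ℝ)| ≤ 3 / 2 := by
    unfold innerResonance
    rw [abs_le]
    rcases Int.units_eq_one_or ε₁ with rfl | rfl <;>
      rcases Int.units_eq_one_or ε₂ with rfl | rfl <;> push_cast [Units.val_one, Units.val_neg] <;>
      constructor <;> linarith
  have := abs_sub_abs_le_abs_sub (innerResonance ε₁ ε₂ ξ η : ℝ)
    (((ε₁ : ℤ) : ℝ) * A + ((ε₂ : ℤ) : ℝ) * B - (((1 : ℤˣ) : ℤ) : ℝ) * C)
  rw [abs_sub_comm] at hdiff
  linarith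

theorem normalFormSymbol_eq_zero {α : ℝ} {ε₁ ε₂ : ℤˣ} {ξ η : ℤ}
    (h : ¬ (ξ ≠ 0 ∧ η ≠ 0 ∧ ξ + η ≠ 0)) : normalFormSymbol α 1 ε₁ ε₂ ξ η = 0 := by
  rw [normalFormSymbol, if_pos]
  simp only [mul_eq_zero]
  tauto

/-- The factor ⟨m⟩^α supplied by the outer operator cancels the one in the symbol, and |m|/⟨m⟩ ≤ 1.
The constant is 4 = (1/2) · 8, the 8 coming from the denominator. -/
theorem abs_normalFormSymbol_le {α : ℝ} (hα : 0 ≤ α) (ε₁ ε₂ : ℤˣ) {ξ η : ℤ} (hξ : ξ ≠ 0)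
    (hη : η ≠ 0) (hm : ξ + η ≠ 0) :
    |normalFormSymbol α 1 ε₁ ε₂ ξ η| * bracket (ξ + η : ℤ) ^ α ≤
      4 * Real.exp (α * (logJ ξ + logJ η) - logJ (innerResonance ε₁ ε₂ ξ η)) := by
  have hden := abs_normalForm_denominator_ge ε₁ ε₂ hξ hη hm
  rw [normalFormSymbol, if_neg (by simp [hξ, hη, hm])]
  set d := ((ε₁ : ℤ) : ℝ) * (|(ξ : ℝ)| * bracket ξ) + ((ε₂ : ℤ) : ℝ) * (|(η : ℝ)| * bracket η)
          - (((1 : ℤˣ) : ℤ) : ℝ) * (|(ξ + η : ℝ)| * bracket (ξ + η))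
  have hDp : 0 < (1 + |(innerResonance ε₁ ε₂ ξ η : ℝ)|) / 8 := by positivity
  have hd : 0 < |d| := hDp.trans_le hden
  have hb := bracket_pos (ξ + η : ℝ)
  have h1 := Real.rpow_nonneg (bracket_pos ξ).le α
  have h2 := Real.rpow_nonneg (bracket_pos η).le α
  have e : |-(1 / 2) * (|(ξ + η : ℝ)| * bracket ξ ^ α * bracket η ^ α) /
      (bracket (ξ + η) ^ (1 + α) * d)| * bracket ((ξ + η : ℤ) : ℝ) ^ α =
      1 / 2 * (|(ξ + η : ℝ)| / bracket (ξ + η)) * (bracket ξ ^ α * bracket η ^ α) / |d| := by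
    push_cast
    rw [abs_div, abs_mul, abs_mul (bracket _ ^ _) d, abs_neg, Real.rpow_add hb, Real.rpow_one,
      abs_of_nonneg (by positivity : 0 ≤ |(ξ + η : ℝ)| * bracket ξ ^ α * bracket η ^ α),
      abs_of_nonneg (by positivity : 0 ≤ bracket (ξ + η : ℝ) * bracket (ξ + η : ℝ) ^ α),
      abs_of_nonneg (by norm_num : (0 : ℝ) ≤ 1 / 2)]
    have : bracket (ξ + η : ℝ) ^ α ≠ 0 := (Real.rpow_pos_of_pos hb _).ne'
    field_simp
  rw [e, Real.exp_sub, exp_logJ, mul_add, Real.exp_add]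
  calc _ ≤ 1 / 2 * 1 * (Real.exp (α * logJ ξ) * Real.exp (α * logJ η)) /
        ((1 + |(innerResonance ε₁ ε₂ ξ η : ℝ)|) / 8) := by
        gcongr
        · exact div_le_one_of_le₀ (abs_le_bracket _) hb.le
        · exact bracket_rpow_le _ hα
        · exact bracket_rpow_le _ hα
    _ = _ := by field_simp; ring

/-- The symbol of `L⁻¹ ⟨∇⟩^{-α} ∂_x²`. -/
noncomputable def outerSymbol (α : ℝ) (n : ℤ) : ℝ :=
  (if n = 0 then 0 else (|(n : ℝ)| * bracket n)⁻¹) * (bracket n ^ (-α) * -(n : ℝ) ^ 2)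

theorem nonlin_apply (α : ℝ) (f g : ℤ → ℂ) (n : ℤ) :
    nonlin α f g n = (outerSymbol α n : ℂ) *
      ∑' m : ℤ, bracketNabla α f m * bracketNabla α g (n - m) := by
  simp only [nonlin, invL, bracketNabla, dxx, multiplier, prodCoeff, outerSymbol]
  push_cast
  ring

theorem outerSymbol_zero (α : ℝ) : outerSymbol α 0 = 0 := by simp [outerSymbol]

theorem abs_outerSymbol_le (α : ℝ) (n : ℤ) : |outerSymbol α n| ≤ bracket n ^ (-α) := by
  have h1 := Real.rpow_nonneg (bracket_pos n).le (-α)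
  rcases eq_or_ne n 0 with rfl | hn
  · rw [outerSymbol_zero, abs_zero]; exact h1
  · have hn' : 0 < |(n : ℝ)| := by positivity
    rw [outerSymbol, if_neg hn, abs_mul, abs_mul, abs_of_nonneg h1, abs_neg,
      abs_of_nonneg (sq_nonneg (n : ℝ)),
      abs_of_nonneg (inv_nonneg.2 (by have := bracket_pos n; positivity)),
      inv_mul_le_iff₀ (mul_pos hn' (bracket_pos n)), mul_comm]
    exact mul_le_mul_of_nonneg_right (sq_le_abs_mul_bracket _) h1

/-- The absolute value of the multiplier of the trilinear operator `N(T(u, v), w)`. -/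
noncomputable def kernelAbs (α : ℝ) (ε₁ ε₂ : ℤˣ) (n : ℤ) (x : ℤ × ℤ) : ℝ :=
  |outerSymbol α n| * (bracket x.1 ^ α * bracket (n - x.1 : ℤ) ^ α *
    |normalFormSymbol α 1 ε₁ ε₂ x.2 (x.1 - x.2)|)

theorem kernelAbs_eq_zero {α : ℝ} {ε₁ ε₂ : ℤˣ} {n : ℤ} {x : ℤ × ℤ} (h : ¬ Admissible n x)
    (hζ : n - x.1 ≠ 0) : kernelAbs α ε₁ ε₂ n x = 0 := by
  rcases eq_or_ne n 0 with rfl | hn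
  · simp [kernelAbs, outerSymbol_zero]
  · rw [kernelAbs, normalFormSymbol_eq_zero, abs_zero, mul_zero, mul_zero]
    rintro ⟨h1, h2, h3⟩
    exact h ⟨hn, by simpa using h3, h1, h2, hζ⟩

/-- The logarithm of the kernel bound is affine in α with slope Z + X + E - N, which is nonnegative
because n is the sum of the inputs; hence α may be raised to a/2. The constant is 2 from ⟨n⟩^{-α}
times 4 from the normal form symbol. -/
theorem bracket_rpow_mul_kernelAbs_le {α γ a κ : ℝ} (hα : 0 ≤ α) (hαa : α ≤ a / 2) (ha : a ≤ 1)
    (hγ : γ ≤ 1 - a - κ) (hκ : 0 ≤ 1 - a - κ) (ε₁ ε₂ : ℤˣ) {n : ℤ} {x : ℤ × ℤ}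
    (hx : Admissible n x) :
    bracket n ^ γ * kernelAbs α ε₁ ε₂ n x ≤ 8 * Real.exp (logWeight a κ ε₁ ε₂ n x / 2) := by
  obtain ⟨m, ξ⟩ := x
  obtain ⟨hn, hm, hξ, hη, hζ⟩ := hx
  dsimp only at *
  have hs := abs_normalFormSymbol_le hα ε₁ ε₂ hξ hη (by simpa using hm)
  rw [add_sub_cancel] at hs
  have hN : logJ n ≤ logJ (n - m) + logJ ξ + logJ (m - ξ) := by
    have h1 := logJ_add_le (n - m) m
    have h2 := logJ_add_le ξ (m - ξ)
    rw [sub_add_cancel] at h1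
    rw [add_sub_cancel] at h2
    linarith
  have hγ' : bracket (n : ℝ) ^ γ ≤ Real.exp ((1 - a - κ) * logJ n) :=
    (Real.rpow_le_rpow_of_exponent_le (one_le_bracket _) hγ).trans (bracket_rpow_le n hκ)
  have ho := (abs_outerSymbol_le α n).trans (bracket_rpow_neg_le n hα (by linarith))
  have hz := bracket_rpow_le (n - m) hα
  have h0 := Real.rpow_nonneg (bracket_pos n).le γ
  have h1 := Real.rpow_nonneg (bracket_pos m).le α
  have h2 := Real.rpow_nonneg (bracket_pos (n - m : ℤ)).le α
  calc bracket (n : ℝ) ^ γ * kernelAbs α ε₁ ε₂ n (m, ξ)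
      = bracket (n : ℝ) ^ γ * |outerSymbol α n| * bracket (n - m : ℤ) ^ α *
        (|normalFormSymbol α 1 ε₁ ε₂ ξ (m - ξ)| * bracket m ^ α) := by
        unfold kernelAbs; dsimp only; ring
    _ ≤ Real.exp ((1 - a - κ) * logJ n) * (2 * Real.exp (-(α * logJ n))) *
        Real.exp (α * logJ (n - m)) * (4 * Real.exp (α * (logJ ξ + logJ (m - ξ)) -
          logJ (innerResonance ε₁ ε₂ ξ (m - ξ)))) := by gcongr
    _ = 8 * Real.exp ((1 - a - κ) * logJ n + -(α * logJ n) + α * logJ (n - m) +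
        (α * (logJ ξ + logJ (m - ξ)) - logJ (innerResonance ε₁ ε₂ ξ (m - ξ)))) := by
        simp only [Real.exp_add]; ring
    _ ≤ _ := by
        gcongr
        unfold logWeight
        dsimp only
        linarith [mul_nonneg (by linarith : 0 ≤ a / 2 - α) (sub_nonneg.2 hN)]

/-- The symbol of the normal form operator is bounded. -/
theorem abs_normalFormSymbol_le_const {α : ℝ} (hα : 0 ≤ α) (hα' : α < 1 / 2) (ε₁ ε₂ : ℤˣ)
    (ξ η : ℤ) : |normalFormSymbol α 1 ε₁ ε₂ ξ η| ≤ 4 * Real.exp (10 * Real.log 2) := by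
  by_cases h : ξ ≠ 0 ∧ η ≠ 0 ∧ ξ + η ≠ 0
  swap
  · rw [normalFormSymbol_eq_zero h, abs_zero]; positivity
  obtain ⟨hξ, hη, hm⟩ := h
  have hl : 0 ≤ Real.log 2 := Real.log_nonneg (by norm_num)
  have hs := abs_normalFormSymbol_le hα ε₁ ε₂ hξ hη hm
  refine (le_mul_of_one_le_right (abs_nonneg _)
    (Real.one_le_rpow (one_le_bracket _) hα)).trans (hs.trans ?_)
  gcongr
  have n1 := logJ_nonneg ξ
  have n2 := logJ_nonneg η
  have n3 := logJ_nonneg (ξ + η)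
  have hX : logJ ξ ≤ logJ (ξ + η) + logJ η := by simpa using logJ_sub_le (ξ + η) η
  have hE : logJ η ≤ logJ (ξ + η) + logJ ξ := by simpa using logJ_sub_le (ξ + η) ξ
  rcases logJ_innerResonance ε₁ ε₂ hξ hη hm with hD | hD | hD
  · nlinarith
  · nlinarith [mul_nonneg hα (sub_nonneg.2 hX)]
  · nlinarith [mul_nonneg hα (sub_nonneg.2 hE)]

/-- A bound at fixed n, used only for absolute convergence. D dominates a product of two of ξ, η, m,
and m can be traded for ζ at the cost of a power of 1 + |n|; after α powers are spent, one input
keeps the decay 1 - α. -/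
theorem bracket_mul_normalFormSymbol_le {α : ℝ} (hα : 0 ≤ α) (hα' : α < 1 / 2) (ε₁ ε₂ : ℤˣ)
    (n : ℤ) (x : ℤ × ℤ) :
    bracket x.1 ^ α * bracket (n - x.1 : ℤ) ^ α * |normalFormSymbol α 1 ε₁ ε₂ x.2 (x.1 - x.2)| ≤
      4 * Real.exp (logJ n + 20 * Real.log 2) * (Real.exp (-((1 - α) * logJ x.2)) +
        Real.exp (-((1 - α) * logJ (x.1 - x.2))) + Real.exp (-((1 - α) * logJ (n - x.1)))) := by
  obtain ⟨m, ξ⟩ := x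
  obtain ⟨η, rfl⟩ : ∃ η, m = ξ + η := ⟨m - ξ, by ring⟩
  simp only [add_sub_cancel_left]
  by_cases h : ξ ≠ 0 ∧ η ≠ 0 ∧ ξ + η ≠ 0
  swap
  · rw [normalFormSymbol_eq_zero h, abs_zero, mul_zero]; positivity
  obtain ⟨hξ, hη, hm⟩ := h
  have hl : 0 ≤ Real.log 2 := Real.log_nonneg (by norm_num)
  have hs := abs_normalFormSymbol_le hα ε₁ ε₂ hξ hη hm
  have n0 := logJ_nonneg n
  have n1 := logJ_nonneg ξ
  have n2 := logJ_nonneg η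
  have n3 := logJ_nonneg (ξ + η)
  have hX := logJ_sub_le_max (ξ + η) η
  have hE := logJ_sub_le_max (ξ + η) ξ
  have hM := logJ_add_le_max ξ η
  rw [add_sub_cancel_right] at hX
  rw [add_sub_cancel_left] at hE
  have hZ := logJ_sub_le n (ξ + η)
  -- In each case the decay is kept on the smaller of the two frequencies in the lower bound for D
  -- (on ζ if that one is m). The larger one pays for the third frequency, which is possible because
  -- 1 - 2α > 0.
  have key : ∃ k ∈ [ξ, η, n - (ξ + η)], α * logJ (n - (ξ + η)) + (α * (logJ ξ + logJ η) -
      logJ (innerResonance ε₁ ε₂ ξ η)) ≤ logJ n + 20 * Real.log 2 + -((1 - α) * logJ k) := by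
    have hZ' := mul_nonneg hα (sub_nonneg.2 hZ)
    have hZ'' := mul_nonneg (by linarith : 0 ≤ 1 - α) (sub_nonneg.2 hZ)
    have hN' := mul_nonneg (by linarith : 0 ≤ 1 - α) n0
    have hl' := mul_nonneg (by linarith : 0 ≤ 1 - α) hl
    rcases logJ_innerResonance ε₁ ε₂ hξ hη hm with hD | hD | hD
    · rcases le_total (logJ ξ) (logJ η) with hle | hle
      · rw [max_eq_right hle] at hM
        refine ⟨ξ, by simp, ?_⟩
        nlinarith [mul_nonneg hα (sub_nonneg.2 hM), mul_nonneg (by linarith : 0 ≤ 1 - 2 * α) n2]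
      · rw [max_eq_left hle] at hM
        refine ⟨η, by simp, ?_⟩
        nlinarith [mul_nonneg hα (sub_nonneg.2 hM), mul_nonneg (by linarith : 0 ≤ 1 - 2 * α) n1]
    · rcases le_total (logJ (ξ + η)) (logJ η) with hle | hle
      · rw [max_eq_right hle] at hX
        refine ⟨n - (ξ + η), by simp, ?_⟩
        nlinarith [mul_nonneg hα (sub_nonneg.2 hX), mul_nonneg (by linarith : 0 ≤ 1 - 2 * α) n2]
      · rw [max_eq_left hle] at hX
        refine ⟨η, by simp, ?_⟩
        nlinarith [mul_nonneg hα (sub_nonneg.2 hX), mul_nonneg (by linarith : 0 ≤ 1 - 2 * α) n3]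
    · rcases le_total (logJ (ξ + η)) (logJ ξ) with hle | hle
      · rw [max_eq_right hle] at hE
        refine ⟨n - (ξ + η), by simp, ?_⟩
        nlinarith [mul_nonneg hα (sub_nonneg.2 hE), mul_nonneg (by linarith : 0 ≤ 1 - 2 * α) n1]
      · rw [max_eq_left hle] at hE
        refine ⟨ξ, by simp, ?_⟩
        nlinarith [mul_nonneg hα (sub_nonneg.2 hE), mul_nonneg (by linarith : 0 ≤ 1 - 2 * α) n3]
  obtain ⟨k, hk, hle⟩ := key
  have h1 := Real.rpow_nonneg (bracket_pos (ξ + η : ℤ)).le α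
  calc _ = bracket (n - (ξ + η) : ℤ) ^ α *
        (|normalFormSymbol α 1 ε₁ ε₂ ξ η| * bracket (ξ + η : ℤ) ^ α) := by ring
    _ ≤ Real.exp (α * logJ (n - (ξ + η))) * (4 * Real.exp (α * (logJ ξ + logJ η) -
          logJ (innerResonance ε₁ ε₂ ξ η))) := by
        gcongr
        exact bracket_rpow_le _ hα
    _ = 4 * Real.exp (α * logJ (n - (ξ + η)) + (α * (logJ ξ + logJ η) -
          logJ (innerResonance ε₁ ε₂ ξ η))) := by rw [Real.exp_add]; ring
    _ ≤ 4 * Real.exp (logJ n + 20 * Real.log 2 + -((1 - α) * logJ k)) := by gcongr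
    _ = 4 * Real.exp (logJ n + 20 * Real.log 2) * Real.exp (-((1 - α) * logJ k)) := by
        rw [Real.exp_add]; ring
    _ ≤ _ := by
        gcongr
        have p1 := (Real.exp_pos (-((1 - α) * logJ ξ))).le
        have p2 := (Real.exp_pos (-((1 - α) * logJ η))).le
        have p3 := (Real.exp_pos (-((1 - α) * logJ (n - (ξ + η))))).le
        simp only [List.mem_cons, List.not_mem_nil, or_false] at hk
        rcases hk with rfl | rfl | rfl <;> linarith

/-! ### Sums and integrals with values in `[0, ∞]` -/

/-- A change of variables whose fibres on `S` have at most two points costs a factor 2; the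
hypothesis says that three points of a fibre are never distinct. -/
theorem tsum_indicator_comp_le {ι ι' : Type*} (F : ι → ι') (S : Set ι) (G : ι' → ℝ≥0∞)
    (hF : ∀ x ∈ S, ∀ y ∈ S, ∀ z ∈ S, F x = F y → F y = F z → x = y ∨ y = z ∨ x = z) :
    ∑' x, S.indicator (fun x => G (F x)) x ≤ 2 * ∑' y, G y := by
  classical
  rw [ENNReal.tsum_eq_iSup_sum]
  refine iSup_le fun T => ?_
  calc ∑ x ∈ T, S.indicator (fun x => G (F x)) x = ∑ x ∈ T with x ∈ S, G (F x) := by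
        rw [Finset.sum_filter]
        exact Finset.sum_congr rfl fun x _ => by simp [Set.indicator_apply]
    _ = ∑ y ∈ (T.filter (· ∈ S)).image F, ((T.filter (· ∈ S)).filter (F · = y)).card • G y :=
        Finset.sum_comp _ _
    _ ≤ ∑ y ∈ (T.filter (· ∈ S)).image F, 2 * G y := by
        refine Finset.sum_le_sum fun y _ => ?_
        rw [nsmul_eq_mul]
        gcongr
        have : ((T.filter (· ∈ S)).filter (F · = y)).card ≤ 2 := by
          by_contra! h
          obtain ⟨x₁, h₁, x₂, h₂, x₃, h₃, h12, h13, h23⟩ := Finset.two_lt_card.1 h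
          simp only [Finset.mem_filter] at h₁ h₂ h₃
          rcases hF x₁ h₁.1.2 x₂ h₂.1.2 x₃ h₃.1.2 (h₁.2.trans h₂.2.symm) (h₂.2.trans h₃.2.symm)
            with h | h | h
          exacts [h12 h, h23 h, h13 h]
        exact_mod_cast this
    _ ≤ 2 * ∑' y, G y := by
        rw [← Finset.mul_sum]
        gcongr
        exact ENNReal.sum_le_tsum _

theorem lintegral_mul_sq_le {Ω : Type*} [MeasurableSpace Ω] (μ : Measure Ω) {f g : Ω → ℝ≥0∞}
    (hf : AEMeasurable f μ) (hg : AEMeasurable g μ) :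
    (∫⁻ x, f x * g x ∂μ) ^ 2 ≤ (∫⁻ x, f x ^ 2 ∂μ) * ∫⁻ x, g x ^ 2 ∂μ := by
  have h := ENNReal.lintegral_mul_le_Lp_mul_Lq μ Real.HolderConjugate.two_two hf hg
  simp only [Pi.mul_apply, ENNReal.rpow_two] at h
  calc _ ≤ ((∫⁻ x, f x ^ 2 ∂μ) ^ (1 / (2 : ℝ)) * (∫⁻ x, g x ^ 2 ∂μ) ^ (1 / (2 : ℝ))) ^ 2 := by
        gcongr
    _ = _ := by
        rw [mul_pow, ← ENNReal.rpow_natCast, ← ENNReal.rpow_natCast, ← ENNReal.rpow_mul,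
          ← ENNReal.rpow_mul]
        norm_num

theorem tsum_mul_sq_le {ι : Type*} (f g : ι → ℝ≥0∞) :
    (∑' i, f i * g i) ^ 2 ≤ (∑' i, f i ^ 2) * ∑' i, g i ^ 2 := by
  let _ : MeasurableSpace ι := ⊤
  have h := lintegral_mul_sq_le (Measure.count : Measure ι) (f := f) (g := g)
    measurable_from_top.aemeasurable measurable_from_top.aemeasurable
  simpa [lintegral_count] using h

theorem add_three_sq_le (x y z : ℝ≥0∞) : (x + y + z) ^ 2 ≤ 9 * (x ^ 2 + y ^ 2 + z ^ 2) := by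
  have h : x + y + z ≤ 3 * max x (max y z) := by
    calc x + y + z ≤ max x (max y z) + max x (max y z) + max x (max y z) := by
          gcongr
          · exact le_max_left _ _
          · exact (le_max_left _ _).trans (le_max_right _ _)
          · exact (le_max_right _ _).trans (le_max_right _ _)
      _ = _ := by ring
  calc _ ≤ (3 * max x (max y z)) ^ 2 := by gcongr
    _ = 9 * (max x (max y z)) ^ 2 := by ring
    _ ≤ _ := by
        gcongr
        rcases max_choice x (max y z) with h | h <;> rw [h]
        · rw [add_assoc]; exact le_self_add
        · rcases max_choice y z with h | h <;> rw [h]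
          · exact le_self_add.trans' (le_add_self)
          · exact le_add_self

/-! ### The discrete estimate -/

/-- The set of nonresonant frequencies. -/
def nonresonantSet (n : ℤ) : Set (ℤ × ℤ) := {x | Nonresonant n x}

/-- The difference of the values at x and y is ±2(x - y)(x + y - c) for equal signs and ±2c(x - y)
for opposite signs. In the second case c ≠ 0 is essential. -/
theorem signed_squares_fiber (e₁ e₂ : ℤˣ) {c : ℤ} (hc : c ≠ 0) {x y z : ℤ}
    (h1 : e₁ * x ^ 2 + e₂ * (c - x) ^ 2 = e₁ * y ^ 2 + e₂ * (c - y) ^ 2)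
    (h2 : e₁ * y ^ 2 + e₂ * (c - y) ^ 2 = e₁ * z ^ 2 + e₂ * (c - z) ^ 2) :
    x = y ∨ y = z ∨ x = z := by
  have key : ∀ {x y : ℤ}, e₁ * x ^ 2 + e₂ * (c - x) ^ 2 = e₁ * y ^ 2 + e₂ * (c - y) ^ 2 →
      x = y ∨ x + y = c := by
    intro x y h
    have : (x - y) * (x + y - c) = 0 ∨ c * (x - y) = 0 := by
      rcases Int.units_eq_one_or e₁ with rfl | rfl <;>
        rcases Int.units_eq_one_or e₂ with rfl | rfl <;>
        simp only [Units.val_one, Units.val_neg] at h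
      · left; linarith
      · right; linarith
      · right; linarith
      · left; linarith
    simp only [mul_eq_zero, hc, false_or] at this
    omega
  rcases key h1 with h1 | h1
  · exact Or.inl h1
  · rcases key h2 with h2 | h2 <;> omega

/-- The linear pairs are injective. For those containing R, fixing the first entry m, η or ξ leaves
R, up to a constant, as a signed sum of two squares whose arguments add up to m, n - η or n - ξ.
`Nonresonant` says that these three numbers are nonzero. -/
theorem freqPair_fiber (ε₁ ε₂ ε₃ : ℤˣ) (n : ℤ) (i : Fin 11) :
    ∀ x ∈ nonresonantSet n, ∀ y ∈ nonresonantSet n, ∀ z ∈ nonresonantSet n,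
      freqPair ε₁ ε₂ ε₃ n i x = freqPair ε₁ ε₂ ε₃ n i y →
      freqPair ε₁ ε₂ ε₃ n i y = freqPair ε₁ ε₂ ε₃ n i z → x = y ∨ y = z ∨ x = z := by
  rintro ⟨m, ξ⟩ ⟨hm, hp, hq⟩ ⟨m', ξ'⟩ - ⟨m'', ξ''⟩ - h1 h2
  dsimp only at hm hp hq
  by_cases hi : i.1 < 8
  · left
    fin_cases i <;> simp [freqPair] at h1 hi ⊢ <;> omega
  obtain rfl | rfl | rfl : i = 8 ∨ i = 9 ∨ i = 10 := by omega
  · obtain ⟨rfl, h1⟩ := Prod.mk.inj h1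
    obtain ⟨rfl, h2⟩ := Prod.mk.inj h2
    simp only [resonance] at h1 h2
    have := signed_squares_fiber ε₁ ε₂ hm (x := ξ) (y := ξ') (z := ξ'') (by linarith) (by linarith)
    simpa using this
  · obtain ⟨e1, h1⟩ := Prod.mk.inj h1
    obtain ⟨e2, h2⟩ := Prod.mk.inj h2
    obtain rfl : m' = m - ξ + ξ' := by linarith
    obtain rfl : m'' = m - ξ + ξ'' := by linarith
    simp only [resonance] at h1 h2
    have := signed_squares_fiber ε₁ ε₃ hq (x := ξ) (y := ξ') (z := ξ'')
      (by ring_nf at h1 ⊢; linarith) (by ring_nf at h2 ⊢; linarith)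
    simp only [Prod.mk.injEq]
    omega
  · obtain ⟨rfl, h1⟩ := Prod.mk.inj h1
    obtain ⟨rfl, h2⟩ := Prod.mk.inj h2
    simp only [resonance] at h1 h2
    have := signed_squares_fiber ε₂ ε₃ hp (x := m - ξ) (y := m' - ξ) (z := m'' - ξ)
      (by ring_nf at h1 ⊢; linarith) (by ring_nf at h2 ⊢; linarith)
    simpa using this

/-- The summable weight `(1 + |k|)^{-r}`. -/
noncomputable def decay (r : ℝ) (k : ℤ) : ℝ≥0∞ := ENNReal.ofReal (Real.exp (-(r * logJ k)))

theorem tsum_decay_lt_top {r : ℝ} (hr : 1 < r) : ∑' k, decay r k < ∞ := by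
  have h : ∀ k : ℤ, Real.exp (-(r * logJ k)) ≤ 1 * |(k : ℝ)| ^ (-r) + if k = 0 then 1 else 0 := by
    intro k
    rcases eq_or_ne k 0 with rfl | hk
    · simp [logJ]
      positivity
    · rw [if_neg hk, add_zero, one_mul, show -(r * logJ k) = logJ k * -r by ring, Real.exp_mul,
        exp_logJ]
      exact Real.rpow_le_rpow_of_nonpos (by positivity) (by linarith) (by linarith)
  have hs : Summable fun k : ℤ => 1 * |(k : ℝ)| ^ (-r) + if k = 0 then (1 : ℝ) else 0 :=
    ((Real.summable_abs_int_rpow hr).mul_left 1).add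
      (summable_of_ne_finset_zero (s := {0}) (by simp +contextual))
  have hs' := Summable.of_nonneg_of_le (fun k => (Real.exp_pos _).le) h hs
  unfold decay
  rw [← ENNReal.ofReal_tsum_of_nonneg (fun k => (Real.exp_pos _).le) hs']
  exact ENNReal.ofReal_lt_top

/-- The weight of the discrete trilinear sum, including the gain from the resonance function. -/
noncomputable def discreteWeight (a κ s : ℝ) (ε₁ ε₂ ε₃ : ℤˣ) (n : ℤ) (x : ℤ × ℤ) : ℝ≥0∞ :=
  open Classical in
  if Admissible n x then ENNReal.ofReal (Real.exp ((logWeight a κ ε₁ ε₂ n x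
    - (1 - s) * logJ (resonance ε₁ ε₂ ε₃ n x)) / 2)) else 0

theorem ofReal_exp_half_sq (y : ℝ) :
    ENNReal.ofReal (Real.exp (y / 2)) ^ 2 = ENNReal.ofReal (Real.exp y) := by
  rw [← ENNReal.ofReal_pow (Real.exp_pos _).le, ← Real.exp_nat_mul]
  congr 2
  push_cast
  ring

theorem discreteWeight_sq_le {a κ s : ℝ} (h : Exponents a κ s) (ε₁ ε₂ ε₃ : ℤˣ) {n : ℤ}
    {x : ℤ × ℤ} (hx : x ∈ nonresonantSet n) :
    discreteWeight a κ s ε₁ ε₂ ε₃ n x ^ 2 ≤ ENNReal.ofReal (Real.exp (100 * Real.log 2)) *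
      ∑ i, decay (1 + s) (freqPair ε₁ ε₂ ε₃ n i x).1 *
        decay (1 + s) (freqPair ε₁ ε₂ ε₃ n i x).2 := by
  unfold discreteWeight
  split_ifs with ha
  · obtain ⟨i, hi⟩ := exists_logWeight_le h ε₁ ε₂ ε₃ ha hx
    rw [ofReal_exp_half_sq]
    calc _ ≤ ENNReal.ofReal (Real.exp (100 * Real.log 2 - (1 + s) *
          (logJ (freqPair ε₁ ε₂ ε₃ n i x).1 + logJ (freqPair ε₁ ε₂ ε₃ n i x).2))) := by gcongr
      _ = ENNReal.ofReal (Real.exp (100 * Real.log 2)) * (decay (1 + s)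
          (freqPair ε₁ ε₂ ε₃ n i x).1 * decay (1 + s) (freqPair ε₁ ε₂ ε₃ n i x).2) := by
          unfold decay
          rw [← ENNReal.ofReal_mul (by positivity), ← ENNReal.ofReal_mul (by positivity),
            ← Real.exp_add, ← Real.exp_add]
          congr 2
          ring
      _ ≤ _ := by
          gcongr
          exact Finset.single_le_sum (f := fun i => decay (1 + s) (freqPair ε₁ ε₂ ε₃ n i x).1 *
            decay (1 + s) (freqPair ε₁ ε₂ ε₃ n i x).2) (fun _ _ => zero_le) (Finset.mem_univ i)
  · simp

theorem tsum_discreteWeight_sq_le {a κ s : ℝ} (h : Exponents a κ s) (ε₁ ε₂ ε₃ : ℤˣ) (n : ℤ) :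
    ∑' x, (nonresonantSet n).indicator (fun x => discreteWeight a κ s ε₁ ε₂ ε₃ n x ^ 2) x ≤
      ENNReal.ofReal (Real.exp (100 * Real.log 2)) * (22 * (∑' k, decay (1 + s) k) ^ 2) := by
  calc _ ≤ ∑' x, ENNReal.ofReal (Real.exp (100 * Real.log 2)) * ∑ i, (nonresonantSet n).indicator
        (fun x => (fun y : ℤ × ℤ => decay (1 + s) y.1 * decay (1 + s) y.2)
          (freqPair ε₁ ε₂ ε₃ n i x)) x := by
        refine ENNReal.tsum_le_tsum fun x => ?_
        by_cases hx : x ∈ nonresonantSet n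
        · simp only [Set.indicator_of_mem hx]
          exact discreteWeight_sq_le h ε₁ ε₂ ε₃ hx
        · simp [Set.indicator_of_notMem hx]
    _ = ENNReal.ofReal (Real.exp (100 * Real.log 2)) * ∑ i, ∑' x, (nonresonantSet n).indicator
        (fun x => (fun y : ℤ × ℤ => decay (1 + s) y.1 * decay (1 + s) y.2)
          (freqPair ε₁ ε₂ ε₃ n i x)) x := by
        rw [ENNReal.tsum_mul_left, Summable.tsum_finsetSum fun _ _ => ENNReal.summable]
    _ ≤ ENNReal.ofReal (Real.exp (100 * Real.log 2)) * ∑ _i : Fin 11,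
        2 * (∑' k, decay (1 + s) k) ^ 2 := by
        gcongr with i
        refine (tsum_indicator_comp_le _ _ (fun y : ℤ × ℤ => decay (1 + s) y.1 * decay (1 + s) y.2)
          (freqPair_fiber ε₁ ε₂ ε₃ n i)).trans_eq ?_
        rw [ENNReal.tsum_prod', sq]
        simp only [ENNReal.tsum_mul_left, ENNReal.tsum_mul_right]
    _ = _ := by
        rw [Finset.sum_const, Finset.card_univ, Fintype.card_fin, nsmul_eq_mul,
          ← mul_assoc ((11 : ℕ) : ℝ≥0∞)]
        norm_num

/-- An admissible frequency that is not nonresonant has ξ = n or η = n. The gain from R is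
discarded; 50 is half of 100 because `logWeight` refers to the square. -/
theorem discreteWeight_le_of_resonant {a κ s : ℝ} (h : Exponents a κ s) (ε₁ ε₂ ε₃ : ℤˣ) {n : ℤ}
    {x : ℤ × ℤ} (hx : x ∉ nonresonantSet n) :
    discreteWeight a κ s ε₁ ε₂ ε₃ n x ≤
      (if n = x.2 then ENNReal.ofReal (Real.exp (50 * Real.log 2)) else 0) +
      (if n = x.1 - x.2 then ENNReal.ofReal (Real.exp (50 * Real.log 2)) else 0) := by
  unfold discreteWeight
  split_ifs with ha h1 h2 h2 <;> try exact zero_le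
  · refine le_add_right ?_
    gcongr
    have := mul_nonneg (by linarith [h.pos, h.le_kappa, h.kappa_le, h.half_lt] : 0 ≤ 1 - s)
      (logJ_nonneg (resonance ε₁ ε₂ ε₃ n x))
    linarith [logWeight_le_of_eq h ε₁ ε₂ ha h1]
  · refine le_add_right ?_
    gcongr
    have := mul_nonneg (by linarith [h.pos, h.le_kappa, h.kappa_le, h.half_lt] : 0 ≤ 1 - s)
      (logJ_nonneg (resonance ε₁ ε₂ ε₃ n x))
    linarith [logWeight_le_of_eq h ε₁ ε₂ ha h1]
  · refine le_add_left ?_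
    gcongr
    have := mul_nonneg (by linarith [h.pos, h.le_kappa, h.kappa_le, h.half_lt] : 0 ≤ 1 - s)
      (logJ_nonneg (resonance ε₁ ε₂ ε₃ n x))
    linarith [logWeight_le_of_eq_sub h ε₁ ε₂ ha h2]
  · exact absurd ⟨ha.m_ne, sub_ne_zero.2 h1, sub_ne_zero.2 h2⟩ hx

theorem tsum_sub_left (f : ℤ → ℝ≥0∞) (n : ℤ) : ∑' m, f (n - m) = ∑' m, f m :=
  (Equiv.subLeft n).tsum_eq f

theorem tsum_sub_right (f : ℤ → ℝ≥0∞) (n : ℤ) : ∑' m, f (m - n) = ∑' m, f m :=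
  (Equiv.subRight n).tsum_eq f

theorem tsum_trilinear (f g h : ℤ → ℝ≥0∞) :
    ∑' n, ∑' x : ℤ × ℤ, f x.2 * g (x.1 - x.2) * h (n - x.1) =
      (∑' k, f k) * (∑' k, g k) * ∑' k, h k := by
  rw [ENNReal.tsum_comm]
  simp only [ENNReal.tsum_mul_left, tsum_sub_right h, ENNReal.tsum_mul_right]
  rw [ENNReal.tsum_prod', ENNReal.tsum_comm]
  simp only [ENNReal.tsum_mul_left, tsum_sub_right g, ENNReal.tsum_mul_right]

/-- On the nonresonant set, Cauchy-Schwarz in (m, ξ) separates the weight, whose square sum is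
bounded uniformly in n, from the sequences. On the two exceptional lines only the sum over m
remains, and Cauchy-Schwarz in m suffices. -/
theorem discrete_estimate {a κ s : ℝ} (h : Exponents a κ s) :
    ∃ C : ℝ≥0∞, C < ∞ ∧ ∀ (ε₁ ε₂ ε₃ : ℤˣ) (f g k : ℤ → ℝ≥0∞),
      ∑' n, (∑' x, discreteWeight a κ s ε₁ ε₂ ε₃ n x *
        (f x.2 * g (x.1 - x.2) * k (n - x.1))) ^ 2 ≤
      C * ((∑' n, f n ^ 2) * (∑' n, g n ^ 2) * ∑' n, k n ^ 2) := by
  have hsum := tsum_decay_lt_top (r := 1 + s) (by linarith [h.pos])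
  set B := ENNReal.ofReal (Real.exp (50 * Real.log 2)) with hB
  set K := ENNReal.ofReal (Real.exp (100 * Real.log 2)) * (22 * (∑' k, decay (1 + s) k) ^ 2) with hK
  have hKt : K < ∞ := ENNReal.mul_lt_top ENNReal.ofReal_lt_top
    (ENNReal.mul_lt_top (by norm_num) (ENNReal.pow_lt_top hsum))
  have hBt : B < ∞ := ENNReal.ofReal_lt_top
  refine ⟨9 * (K + B ^ 2 + B ^ 2), ENNReal.mul_lt_top (by norm_num) (by
    simp only [ENNReal.add_lt_top]; exact ⟨⟨hKt, ENNReal.pow_lt_top hBt⟩, ENNReal.pow_lt_top hBt⟩),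
    fun ε₁ ε₂ ε₃ f g k => ?_⟩
  set N := (∑' n, f n ^ 2) * (∑' n, g n ^ 2) * ∑' n, k n ^ 2 with hN
  have split : ∀ n, (∑' x, discreteWeight a κ s ε₁ ε₂ ε₃ n x *
      (f x.2 * g (x.1 - x.2) * k (n - x.1))) ≤
      (∑' x, (nonresonantSet n).indicator (discreteWeight a κ s ε₁ ε₂ ε₃ n) x *
        (f x.2 * g (x.1 - x.2) * k (n - x.1))) +
      B * (f n * ∑' m, g (m - n) * k (n - m)) + B * (g n * ∑' m, f (m - n) * k (n - m)) := by
    intro n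
    have e1 : B * (f n * ∑' m, g (m - n) * k (n - m)) = ∑' x : ℤ × ℤ,
        (if n = x.2 then B else 0) * (f x.2 * g (x.1 - x.2) * k (n - x.1)) := by
      rw [ENNReal.tsum_prod', ← ENNReal.tsum_mul_left, ← ENNReal.tsum_mul_left]
      refine tsum_congr fun m => ?_
      rw [tsum_eq_single n fun ξ hξ => by rw [if_neg hξ.symm, zero_mul]]
      simp [mul_assoc]
    have e2 : B * (g n * ∑' m, f (m - n) * k (n - m)) = ∑' x : ℤ × ℤ,
        (if n = x.1 - x.2 then B else 0) * (f x.2 * g (x.1 - x.2) * k (n - x.1)) := by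
      rw [ENNReal.tsum_prod', ← ENNReal.tsum_mul_left, ← ENNReal.tsum_mul_left]
      refine tsum_congr fun m => ?_
      rw [tsum_eq_single (m - n) fun ξ hξ => by
        rw [if_neg (by dsimp only; omega), zero_mul]]
      simp
      ring
    rw [e1, e2, ← ENNReal.tsum_add, ← ENNReal.tsum_add]
    refine ENNReal.tsum_le_tsum fun x => ?_
    rw [← add_mul, ← add_mul]
    gcongr
    by_cases hx : x ∈ nonresonantSet n
    · rw [Set.indicator_of_mem hx, add_assoc]
      exact le_self_add
    · rw [Set.indicator_of_notMem hx, zero_add]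
      exact discreteWeight_le_of_resonant h ε₁ ε₂ ε₃ hx
  have b1 : ∑' n, (∑' x, (nonresonantSet n).indicator (discreteWeight a κ s ε₁ ε₂ ε₃ n) x *
        (f x.2 * g (x.1 - x.2) * k (n - x.1))) ^ 2 ≤ K * N := by
    calc _ ≤ ∑' n, K * ∑' x : ℤ × ℤ, f x.2 ^ 2 * g (x.1 - x.2) ^ 2 * k (n - x.1) ^ 2 := by
          refine ENNReal.tsum_le_tsum fun n => (tsum_mul_sq_le _ _).trans ?_
          simp only [mul_pow]
          gcongr
          refine le_trans (ENNReal.tsum_le_tsum fun x => ?_)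
            (tsum_discreteWeight_sq_le h ε₁ ε₂ ε₃ n)
          by_cases hx : x ∈ nonresonantSet n <;> simp [hx]
      _ = _ := by
          rw [ENNReal.tsum_mul_left, tsum_trilinear (fun m => f m ^ 2) (fun m => g m ^ 2)
            fun m => k m ^ 2]
  have resonant : ∀ f g : ℤ → ℝ≥0∞, ∑' n, (B * (f n * ∑' m, g (m - n) * k (n - m))) ^ 2 ≤
      B ^ 2 * ((∑' n, f n ^ 2) * ((∑' n, g n ^ 2) * ∑' n, k n ^ 2)) := by
    intro f g
    simp only [mul_pow]
    rw [ENNReal.tsum_mul_left, ← ENNReal.tsum_mul_right]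
    gcongr with n
    refine (tsum_mul_sq_le _ _).trans_eq ?_
    rw [tsum_sub_right (fun m => g m ^ 2), tsum_sub_left (fun m => k m ^ 2)]
  calc _ ≤ ∑' n, 9 * ((∑' x, (nonresonantSet n).indicator (discreteWeight a κ s ε₁ ε₂ ε₃ n) x *
        (f x.2 * g (x.1 - x.2) * k (n - x.1))) ^ 2 +
      (B * (f n * ∑' m, g (m - n) * k (n - m))) ^ 2 +
      (B * (g n * ∑' m, f (m - n) * k (n - m))) ^ 2) := by
        refine ENNReal.tsum_le_tsum fun n => le_trans ?_ (add_three_sq_le _ _ _)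
        gcongr
        exact split n
    _ ≤ 9 * (K * N + B ^ 2 * N + B ^ 2 * N) := by
        rw [ENNReal.tsum_mul_left, ENNReal.tsum_add, ENNReal.tsum_add]
        gcongr
        · exact (resonant f g).trans_eq (by rw [hN]; ring)
        · exact (resonant g f).trans_eq (by rw [hN]; ring)
    _ = _ := by ring

section Modulation

/-! ### Convolutions in the time frequency -/

theorem lintegral_mul_le_of_sq_le {Ω : Type*} [MeasurableSpace Ω] (μ : Measure Ω) {f g : Ω → ℝ≥0∞}
    (hf : AEMeasurable f μ) (hg : AEMeasurable g μ) {F G : ℝ≥0∞} (hF : ∫⁻ x, f x ^ 2 ∂μ ≤ F ^ 2)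
    (hG : ∫⁻ x, g x ^ 2 ∂μ ≤ G ^ 2) : ∫⁻ x, f x * g x ∂μ ≤ F * G := by
  have h : (∫⁻ x, f x * g x ∂μ) ^ 2 ≤ (F * G) ^ 2 :=
    (lintegral_mul_sq_le μ hf hg).trans (by rw [mul_pow]; gcongr)
  exact (ENNReal.pow_right_strictMono two_ne_zero).le_iff_le.1 h

/-- Minkowski's inequality in L²: the square is expanded into a double series and Cauchy-Schwarz is
applied to each term. -/
theorem lintegral_tsum_sq_le {Ω ι : Type*} [MeasurableSpace Ω] [Countable ι] (μ : Measure Ω)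
    {A : ι → Ω → ℝ≥0∞} (hA : ∀ i, AEMeasurable (A i) μ) {B : ι → ℝ≥0∞}
    (h : ∀ i, ∫⁻ x, A i x ^ 2 ∂μ ≤ B i ^ 2) :
    ∫⁻ x, (∑' i, A i x) ^ 2 ∂μ ≤ (∑' i, B i) ^ 2 := by
  have hm : ∀ i j, AEMeasurable (fun x => A j x * A i x) μ := fun i j => (hA j).mul (hA i)
  simp only [sq, ← ENNReal.tsum_mul_left, ← ENNReal.tsum_mul_right]
  rw [lintegral_tsum fun i => AEMeasurable.tsum fun j => hm i j]
  gcongr with i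
  rw [lintegral_tsum fun j => hm i j]
  gcongr with j
  exact lintegral_mul_le_of_sq_le μ (hA j) (hA i) (h j) (h i)

/-- The convolution of two functions with values in `[0, ∞]`. -/
noncomputable def lconv (f g : ℝ → ℝ≥0∞) (x : ℝ) : ℝ≥0∞ := ∫⁻ t, f t * g (x - t)

variable {f g h : ℝ → ℝ≥0∞}

theorem measurable_lconv (hf : Measurable f) (hg : Measurable g) : Measurable (lconv f g) := by
  unfold lconv
  exact Measurable.lintegral_prod_right' (f := fun p : ℝ × ℝ => f p.2 * g (p.1 - p.2))
    (by fun_prop)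

theorem lconv_comm (f g : ℝ → ℝ≥0∞) : lconv f g = lconv g f := by
  ext x
  unfold lconv
  rw [← lintegral_sub_left_eq_self _ x]
  simp [mul_comm]

theorem lintegral_lconv (hf : Measurable f) (hg : Measurable g) :
    ∫⁻ x, lconv f g x = (∫⁻ x, f x) * ∫⁻ x, g x := by
  unfold lconv
  rw [lintegral_lintegral_swap (by fun_prop), ← lintegral_mul_const _ hf]
  refine lintegral_congr fun t => ?_
  rw [lintegral_const_mul _ (by fun_prop), lintegral_sub_right_eq_self]

/-- Young's inequality for L¹ and L², by Cauchy-Schwarz with respect to the measure f dt. -/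
theorem lintegral_lconv_sq_le (hf : Measurable f) (hg : Measurable g) :
    ∫⁻ x, lconv f g x ^ 2 ≤ (∫⁻ x, f x) ^ 2 * ∫⁻ x, g x ^ 2 := by
  calc ∫⁻ x, lconv f g x ^ 2 ≤ ∫⁻ x, (∫⁻ t, f t) * ∫⁻ t, f t * g (x - t) ^ 2 := by
        refine lintegral_mono fun x => ?_
        have e : ∀ t, f t * g (x - t) = f t ^ (1 / 2 : ℝ) * (f t ^ (1 / 2 : ℝ) * g (x - t)) := by
          intro t
          rw [← mul_assoc, ← ENNReal.rpow_add_of_nonneg _ _ (by norm_num) (by norm_num)]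
          norm_num
        have e2 : ∀ t, (f t ^ (1 / 2 : ℝ)) ^ 2 = f t := by
          intro t
          rw [← ENNReal.rpow_natCast, ← ENNReal.rpow_mul]
          norm_num
        unfold lconv
        simp only [e]
        refine (lintegral_mul_sq_le _ (by fun_prop) (by fun_prop)).trans_eq ?_
        simp only [mul_pow, e2]
    _ = _ := by
        have := lintegral_lconv hf (hg.pow_const 2)
        unfold lconv at this
        rw [lintegral_const_mul _ (Measurable.lintegral_prod_right'
          (f := fun p : ℝ × ℝ => f p.2 * g (p.1 - p.2) ^ 2) (by fun_prop)), this, sq, mul_assoc]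

/-! ### Modulation weights -/

/-- The modulation weight `(1 + |σ|)^r`. -/
noncomputable def modWeight (r σ : ℝ) : ℝ≥0∞ := ENNReal.ofReal ((1 + |σ|) ^ r)

theorem measurable_modWeight (r : ℝ) : Measurable (modWeight r) := by
  unfold modWeight; fun_prop

theorem one_le_modWeight {r : ℝ} (hr : 0 ≤ r) (σ : ℝ) : 1 ≤ modWeight r σ := by
  rw [modWeight, ENNReal.one_le_ofReal]
  exact Real.one_le_rpow (by linarith [abs_nonneg σ]) hr

theorem modWeight_mul (r r' σ : ℝ) : modWeight r σ * modWeight r' σ = modWeight (r + r') σ := by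
  unfold modWeight
  rw [← ENNReal.ofReal_mul (by positivity), ← Real.rpow_add (by positivity)]

theorem modWeight_zero (σ : ℝ) : modWeight 0 σ = 1 := by simp [modWeight]

theorem modWeight_mono {r r' : ℝ} (h : r ≤ r') (σ : ℝ) : modWeight r σ ≤ modWeight r' σ := by
  unfold modWeight
  gcongr
  linarith [abs_nonneg σ]

theorem modWeight_sq (r σ : ℝ) : modWeight r σ ^ 2 = modWeight (2 * r) σ := by
  rw [sq, modWeight_mul, two_mul]

theorem modWeight_add_le {r : ℝ} (hr : 0 ≤ r) (hr' : r ≤ 1) (x y z w : ℝ) :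
    modWeight r (x + y + z + w) ≤
      modWeight r x + modWeight r y + modWeight r z + modWeight r w := by
  have h2 : ∀ x y : ℝ, modWeight r (x + y) ≤ modWeight r x + modWeight r y := by
    intro x y
    unfold modWeight
    rw [← ENNReal.ofReal_add (by positivity) (by positivity)]
    refine ENNReal.ofReal_le_ofReal ?_
    refine le_trans ?_ (Real.rpow_add_le_add_rpow (by positivity) (by positivity) hr hr')
    exact Real.rpow_le_rpow (by positivity) (by linarith [abs_add_le x y]) hr
  calc _ ≤ modWeight r (x + y + z) + modWeight r w := h2 _ _
    _ ≤ modWeight r (x + y) + modWeight r z + modWeight r w := by gcongr; exact h2 _ _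
    _ ≤ _ := by gcongr; exact h2 _ _

theorem lintegral_modWeight_lt_top {r : ℝ} (hr : r < -1) : ∫⁻ σ, modWeight r σ < ∞ := by
  have := finite_integral_one_add_norm (E := ℝ) (μ := volume) (r := -r)
    (by rw [Module.finrank_self]; push_cast; linarith)
  simpa [modWeight, Real.norm_eq_abs] using this

/-- `L¹` norms in the time frequency are controlled by weighted `L²` norms. -/
theorem lintegral_sq_le_modWeight (hf : Measurable f) (r p : ℝ) :
    (∫⁻ τ, f τ) ^ 2 ≤
      (∫⁻ σ, modWeight (-r) σ) * ∫⁻ τ, modWeight r (τ - p) * f τ ^ 2 := by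
  have hm := measurable_modWeight
  have e : ∀ τ, f τ = modWeight (-r / 2) (τ - p) * (modWeight (r / 2) (τ - p) * f τ) := by
    intro τ
    rw [← mul_assoc, modWeight_mul, neg_div, neg_add_cancel, modWeight_zero, one_mul]
  calc (∫⁻ τ, f τ) ^ 2
      = (∫⁻ τ, modWeight (-r / 2) (τ - p) * (modWeight (r / 2) (τ - p) * f τ)) ^ 2 := by
        simp only [← e]
    _ ≤ _ := lintegral_mul_sq_le _
        ((hm _).comp (measurable_id.sub_const p)).aemeasurable
        (((hm _).comp (measurable_id.sub_const p)).mul hf).aemeasurable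
    _ = _ := by
        simp only [mul_pow, modWeight_sq]
        rw [lintegral_sub_right_eq_self (fun σ => modWeight (2 * (-r / 2)) σ)]
        congr 2
        · ext σ; congr 1; ring
        · ext τ; congr 2; ring

theorem add_four_sq_le (x y z w : ℝ≥0∞) :
    (x + y + z + w) ^ 2 ≤ 81 * (x ^ 2 + y ^ 2 + z ^ 2 + w ^ 2) := by
  calc (x + y + z + w) ^ 2 ≤ 9 * ((x + y) ^ 2 + z ^ 2 + w ^ 2) := add_three_sq_le _ _ _
    _ ≤ 9 * (9 * (x ^ 2 + y ^ 2) + 9 * z ^ 2 + 9 * w ^ 2) := by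
        gcongr
        · simpa using add_three_sq_le x y 0
        · exact le_mul_of_one_le_left' (by norm_num)
        · exact le_mul_of_one_le_left' (by norm_num)
    _ = _ := by ring

theorem lintegral_add_four {Ω : Type*} [MeasurableSpace Ω] {μ : Measure Ω}
    {f₁ f₂ f₃ : Ω → ℝ≥0∞} (h₁ : Measurable f₁) (h₂ : Measurable f₂) (h₃ : Measurable f₃)
    (f₄ : Ω → ℝ≥0∞) : ∫⁻ x, f₁ x + f₂ x + f₃ x + f₄ x ∂μ =
      ∫⁻ x, f₁ x ∂μ + ∫⁻ x, f₂ x ∂μ + ∫⁻ x, f₃ x ∂μ + ∫⁻ x, f₄ x ∂μ := by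
  rw [← lintegral_add_left h₁, ← lintegral_add_left (by fun_prop),
    ← lintegral_add_left (by fun_prop)]

/-- The triple convolution written as a double integral. -/
theorem lconv_lconv_apply (hf : Measurable f) (hg : Measurable g) (h : ℝ → ℝ≥0∞) (τ : ℝ) :
    lconv (lconv f g) h τ = ∫⁻ y, ∫⁻ t, f t * g (y - t) * h (τ - y) := by
  unfold lconv
  exact lintegral_congr fun y => (lintegral_mul_const _ (by fun_prop)).symm

/-- The number p - p₁ - p₂ - p₃ is the sum of the three input modulations minus the output
modulation τ - p, whatever the convolution variables are. Subadditivity of (1 + |σ|)^ρ for 0 ≤ ρ ≤ 1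
therefore moves the weight onto one of the four, and the output weight cancels the first term. -/
theorem modWeight_mul_lconv_le (hf : Measurable f) (hg : Measurable g) (hh : Measurable h)
    {ρ : ℝ} (hρ : 0 ≤ ρ) (hρ' : ρ ≤ 1) (p p₁ p₂ p₃ τ : ℝ) :
    modWeight ρ (p - p₁ - p₂ - p₃) * (modWeight (-ρ) (τ - p) * lconv (lconv f g) h τ) ≤
      lconv (lconv f g) h τ + lconv (lconv (fun t => modWeight ρ (t - p₁) * f t) g) h τ +
      lconv (lconv f (fun t => modWeight ρ (t - p₂) * g t)) h τ +
      lconv (lconv f g) (fun t => modWeight ρ (t - p₃) * h t) τ := by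
  have hm := measurable_modWeight ρ
  have m1 : Measurable fun t => modWeight ρ (t - p₁) * f t :=
    (hm.comp (measurable_id.sub_const p₁)).mul hf
  have m2 : Measurable fun t => modWeight ρ (t - p₂) * g t :=
    (hm.comp (measurable_id.sub_const p₂)).mul hg
  have m3 : Measurable fun t => modWeight ρ (t - p₃) * h t :=
    (hm.comp (measurable_id.sub_const p₃)).mul hh
  have hneg : modWeight (-ρ) (τ - p) ≤ 1 := by
    rw [← modWeight_zero (τ - p)]; exact modWeight_mono (by linarith) _
  have key : modWeight ρ (p - p₁ - p₂ - p₃) * lconv (lconv f g) h τ ≤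
      modWeight ρ (τ - p) * lconv (lconv f g) h τ +
      lconv (lconv (fun t => modWeight ρ (t - p₁) * f t) g) h τ +
      lconv (lconv f (fun t => modWeight ρ (t - p₂) * g t)) h τ +
      lconv (lconv f g) (fun t => modWeight ρ (t - p₃) * h t) τ := by
    rw [lconv_lconv_apply hf hg, lconv_lconv_apply m1 hg, lconv_lconv_apply hf m2,
      lconv_lconv_apply hf hg]
    have q0 : Measurable fun q : ℝ × ℝ => f q.2 * g (q.1 - q.2) * h (τ - q.1) := by fun_prop
    have q1 : Measurable fun q : ℝ × ℝ =>
      modWeight ρ (q.2 - p₁) * f q.2 * g (q.1 - q.2) * h (τ - q.1) := by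
      have : Measurable fun q : ℝ × ℝ => modWeight ρ (q.2 - p₁) * f q.2 := m1.comp measurable_snd
      fun_prop
    have q2 : Measurable fun q : ℝ × ℝ =>
      f q.2 * (modWeight ρ (q.1 - q.2 - p₂) * g (q.1 - q.2)) * h (τ - q.1) := by
      have : Measurable fun q : ℝ × ℝ => modWeight ρ (q.1 - q.2 - p₂) * g (q.1 - q.2) :=
        m2.comp (measurable_fst.sub measurable_snd)
      fun_prop
    have q3 : Measurable fun q : ℝ × ℝ =>
      f q.2 * g (q.1 - q.2) * (modWeight ρ (τ - q.1 - p₃) * h (τ - q.1)) := by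
      have : Measurable fun q : ℝ × ℝ => modWeight ρ (τ - q.1 - p₃) * h (τ - q.1) :=
        m3.comp (measurable_const.sub measurable_fst)
      fun_prop
    rw [lintegral_lintegral q0.aemeasurable, lintegral_lintegral q1.aemeasurable,
      lintegral_lintegral q2.aemeasurable, lintegral_lintegral q3.aemeasurable,
      ← lintegral_const_mul _ q0, ← lintegral_const_mul _ q0,
      ← lintegral_add_four (q0.const_mul _) q1 q2]
    refine lintegral_mono fun q => ?_
    have := modWeight_add_le hρ hρ' (-(τ - p)) (q.2 - p₁) (q.1 - q.2 - p₂) (τ - q.1 - p₃)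
    have e : modWeight ρ (-(τ - p)) = modWeight ρ (τ - p) := by simp only [modWeight, abs_neg]
    rw [e, show -(τ - p) + (q.2 - p₁) + (q.1 - q.2 - p₂) + (τ - q.1 - p₃) = p - p₁ - p₂ - p₃ by
      ring] at this
    calc _ ≤ (modWeight ρ (τ - p) + modWeight ρ (q.2 - p₁) + modWeight ρ (q.1 - q.2 - p₂) +
          modWeight ρ (τ - q.1 - p₃)) * (f q.2 * g (q.1 - q.2) * h (τ - q.1)) := by gcongr
      _ = _ := by ring
  calc _ = modWeight (-ρ) (τ - p) * (modWeight ρ (p - p₁ - p₂ - p₃) * lconv (lconv f g) h τ) := by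
        ring
    _ ≤ _ := mul_le_mul_right key _
    _ ≤ _ := by
        rw [mul_add, mul_add, mul_add, ← mul_assoc, modWeight_mul, neg_add_cancel, modWeight_zero,
          one_mul]
        gcongr <;> exact mul_le_of_le_one_left' hneg

/-- The weighted `L²` bound for a triple convolution, with the gain from the resonance function. -/
theorem lintegral_modWeight_lconv_le (hf : Measurable f) (hg : Measurable g) (hh : Measurable h)
    {ρ r : ℝ} (hρ : 0 ≤ ρ) (hρ' : ρ ≤ 1) (hr : 2 * ρ ≤ r) (p p₁ p₂ p₃ : ℝ) :
    ∫⁻ τ, (modWeight ρ (p - p₁ - p₂ - p₃) *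
        (modWeight (-ρ) (τ - p) * lconv (lconv f g) h τ)) ^ 2 ≤
      324 * (∫⁻ σ, modWeight (-r) σ) ^ 2 * ((∫⁻ τ, modWeight r (τ - p₁) * f τ ^ 2) *
        (∫⁻ τ, modWeight r (τ - p₂) * g τ ^ 2) * ∫⁻ τ, modWeight r (τ - p₃) * h τ ^ 2) := by
  have hm := measurable_modWeight ρ
  have m1 : Measurable fun t => modWeight ρ (t - p₁) * f t :=
    (hm.comp (measurable_id.sub_const p₁)).mul hf
  have m2 : Measurable fun t => modWeight ρ (t - p₂) * g t :=
    (hm.comp (measurable_id.sub_const p₂)).mul hg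
  have m3 : Measurable fun t => modWeight ρ (t - p₃) * h t :=
    (hm.comp (measurable_id.sub_const p₃)).mul hh
  set I := ∫⁻ σ, modWeight (-r) σ
  have L1 : ∀ {f : ℝ → ℝ≥0∞} (p : ℝ), Measurable f →
    (∫⁻ τ, f τ) ^ 2 ≤ I * ∫⁻ τ, modWeight r (τ - p) * f τ ^ 2 := fun p hf =>
      lintegral_sq_le_modWeight hf r p
  have L2 : ∀ (f : ℝ → ℝ≥0∞) (p : ℝ), ∫⁻ τ, (modWeight ρ (τ - p) * f τ) ^ 2 ≤
      ∫⁻ τ, modWeight r (τ - p) * f τ ^ 2 := by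
    intro f p
    refine lintegral_mono fun τ => ?_
    dsimp only
    rw [mul_pow, modWeight_sq]
    gcongr
    exact modWeight_mono hr _
  have L2' : ∀ (f : ℝ → ℝ≥0∞) (p : ℝ), ∫⁻ τ, f τ ^ 2 ≤ ∫⁻ τ, modWeight r (τ - p) * f τ ^ 2 :=
    fun f p => lintegral_mono fun τ =>
      le_mul_of_one_le_left' (one_le_modWeight (by linarith) _)
  have triple : ∀ {f g h : ℝ → ℝ≥0∞}, Measurable f → Measurable g → Measurable h →
      ∫⁻ τ, lconv (lconv f g) h τ ^ 2 ≤ (∫⁻ τ, f τ) ^ 2 * (∫⁻ τ, g τ) ^ 2 * ∫⁻ τ, h τ ^ 2 := by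
    intro f g h hf hg hh
    refine (lintegral_lconv_sq_le (measurable_lconv hf hg) hh).trans_eq ?_
    rw [lintegral_lconv hf hg, mul_pow]
  have triple' : ∀ {f g h : ℝ → ℝ≥0∞}, Measurable f → Measurable g → Measurable h →
      ∫⁻ τ, lconv (lconv f g) h τ ^ 2 ≤ (∫⁻ τ, f τ) ^ 2 * (∫⁻ τ, g τ ^ 2) * (∫⁻ τ, h τ) ^ 2 := by
    intro f g h hf hg hh
    rw [lconv_comm]
    refine (lintegral_lconv_sq_le hh (measurable_lconv hf hg)).trans ?_
    rw [mul_comm]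
    gcongr
    exact lintegral_lconv_sq_le hf hg
  set A := ∫⁻ τ, modWeight r (τ - p₁) * f τ ^ 2
  set B := ∫⁻ τ, modWeight r (τ - p₂) * g τ ^ 2
  set C := ∫⁻ τ, modWeight r (τ - p₃) * h τ ^ 2
  -- The factor that carries the extra weight is measured in L² and the other two in L¹; when no
  -- input carries it, the choice of `h` for L² is arbitrary.
  have c1 : ∫⁻ τ, lconv (lconv f g) h τ ^ 2 ≤ I ^ 2 * (A * B * C) :=
    (triple hf hg hh).trans <| (mul_le_mul' (mul_le_mul' (L1 p₁ hf) (L1 p₂ hg)) (L2' h p₃)).trans_eq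
      (by ring)
  have c2 : ∫⁻ τ, lconv (lconv (fun t => modWeight ρ (t - p₁) * f t) g) h τ ^ 2 ≤
      I ^ 2 * (A * B * C) := by
    rw [lconv_comm (fun t => modWeight ρ (t - p₁) * f t) g]
    exact (triple' hg m1 hh).trans <| (mul_le_mul' (mul_le_mul' (L1 p₂ hg) (L2 f p₁))
      (L1 p₃ hh)).trans_eq (by ring)
  have c3 : ∫⁻ τ, lconv (lconv f (fun t => modWeight ρ (t - p₂) * g t)) h τ ^ 2 ≤
      I ^ 2 * (A * B * C) :=
    (triple' hf m2 hh).trans <| (mul_le_mul' (mul_le_mul' (L1 p₁ hf) (L2 g p₂))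
      (L1 p₃ hh)).trans_eq (by ring)
  have c4 : ∫⁻ τ, lconv (lconv f g) (fun t => modWeight ρ (t - p₃) * h t) τ ^ 2 ≤
      I ^ 2 * (A * B * C) :=
    (triple hf hg m3).trans <| (mul_le_mul' (mul_le_mul' (L1 p₁ hf) (L1 p₂ hg))
      (L2 h p₃)).trans_eq (by ring)
  have n1 := (measurable_lconv (measurable_lconv hf hg) hh).pow_const 2
  have n2 := (measurable_lconv (measurable_lconv m1 hg) hh).pow_const 2
  have n3 := (measurable_lconv (measurable_lconv hf m2) hh).pow_const 2
  calc _ ≤ ∫⁻ τ, 81 * (lconv (lconv f g) h τ ^ 2 +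
        lconv (lconv (fun t => modWeight ρ (t - p₁) * f t) g) h τ ^ 2 +
        lconv (lconv f (fun t => modWeight ρ (t - p₂) * g t)) h τ ^ 2 +
        lconv (lconv f g) (fun t => modWeight ρ (t - p₃) * h t) τ ^ 2) := by
        refine lintegral_mono fun τ => le_trans ?_ (add_four_sq_le _ _ _ _)
        gcongr
        exact modWeight_mul_lconv_le hf hg hh hρ hρ' p p₁ p₂ p₃ τ
    _ ≤ 81 * (I ^ 2 * (A * B * C) + I ^ 2 * (A * B * C) + I ^ 2 * (A * B * C) +
        I ^ 2 * (A * B * C)) := by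
        rw [lintegral_const_mul' _ _ (by norm_num), lintegral_add_four n1 n2 n3]
        gcongr
    _ = _ := by ring

end Modulation

section TimeFourier

open scoped Convolution

/-! ### Time Fourier transforms of products and series -/

theorem integral_mul_exp_eq_fourier {H : ℝ → ℂ} (hH : Integrable H) (t : ℝ) :
    ∫ τ : ℝ, H τ * Complex.exp (Complex.I * t * τ) =
      FourierTransform.fourier H (-(t / (2 * Real.pi))) := by
  have h : IsTimeFourier (fun t : ℝ => ∫ τ : ℝ, H τ * Complex.exp (Complex.I * t * τ)) H :=
    ⟨hH, fun _ => rfl⟩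
  rw [fourier_eq_of_isTimeFourier h]
  have e : -(2 * Real.pi * -(t / (2 * Real.pi))) = t := by
    have := Real.pi_ne_zero
    field_simp
  rw [e]

theorem IsTimeFourier.mul {h₁ h₂ H₁ H₂ : ℝ → ℂ} (hh₁ : IsTimeFourier h₁ H₁)
    (hh₂ : IsTimeFourier h₂ H₂) :
    IsTimeFourier (fun t => h₁ t * h₂ t) (H₁ ⋆[ContinuousLinearMap.mul ℂ ℂ] H₂) := by
  have hi := hh₁.1.integrable_convolution (ContinuousLinearMap.mul ℂ ℂ) hh₂.1
  refine ⟨hi, fun t => ?_⟩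
  rw [integral_mul_exp_eq_fourier hi, Real.fourier_mul_convolution_eq hh₁.1 hh₂.1,
    ← integral_mul_exp_eq_fourier hh₁.1, ← integral_mul_exp_eq_fourier hh₂.1, ← hh₁.2, ← hh₂.2]

theorem IsTimeFourier.const_mul {h H : ℝ → ℂ} (hh : IsTimeFourier h H) (c : ℂ) :
    IsTimeFourier (fun t => c * h t) (fun τ => c * H τ) :=
  ⟨hh.1.const_mul c, fun t => by
    dsimp only; rw [hh.2, ← integral_const_mul]; simp only [mul_assoc]⟩

theorem IsTimeFourier.enorm_le {h H : ℝ → ℂ} (hh : IsTimeFourier h H) (t : ℝ) :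
    ‖h t‖ₑ ≤ ∫⁻ τ, ‖H τ‖ₑ := by
  rw [hh.2]
  refine (enorm_integral_le_lintegral_enorm _).trans_eq (lintegral_congr fun τ => ?_)
  rw [enorm_mul, show Complex.I * t * τ = ((t * τ : ℝ) : ℂ) * Complex.I by push_cast; ring,
    ← ofReal_norm, ← ofReal_norm (Complex.exp _), Complex.norm_exp_ofReal_mul_I]
  simp

theorem summable_of_tsum_enorm_lt_top {ι : Type*} {f : ι → ℂ} (h : ∑' i, ‖f i‖ₑ < ∞) :
    Summable f := by
  refine Summable.of_norm ?_
  have : Summable fun i => ‖f i‖₊ := ENNReal.tsum_coe_ne_top_iff_summable.1 h.ne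
  exact NNReal.summable_coe.2 this

theorem IsTimeFourier.summable {ι : Type*} {h H : ι → ℝ → ℂ}
    (hh : ∀ i, IsTimeFourier (h i) (H i)) (hs : ∑' i, ∫⁻ τ, ‖H i τ‖ₑ < ∞) (t : ℝ) :
    Summable fun i => h i t :=
  summable_of_tsum_enorm_lt_top
    ((ENNReal.tsum_le_tsum fun i => (hh i).enorm_le t).trans_lt hs)

theorem IsTimeFourier.tsum {ι : Type*} [Countable ι] {h H : ι → ℝ → ℂ}
    (hh : ∀ i, IsTimeFourier (h i) (H i)) (hs : ∑' i, ∫⁻ τ, ‖H i τ‖ₑ < ∞) :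
    IsTimeFourier (fun t => ∑' i, h i t) (fun τ => ∑' i, H i τ) := by
  have hm : ∀ i, AEMeasurable (H i) := fun i => (hh i).1.aemeasurable
  refine ⟨⟨(AEMeasurable.tsum hm).aestronglyMeasurable, ?_⟩, fun t => ?_⟩
  · refine lt_of_le_of_lt (lintegral_mono fun τ => enorm_tsum_le_tsum_enorm) ?_
    rw [lintegral_tsum fun i => (hm i).enorm]
    exact hs
  · have hexp : Measurable fun τ : ℝ => Complex.exp (Complex.I * t * τ) := by fun_prop
    simp only [fun i => (hh i).2 t, ← tsum_mul_right]
    refine (integral_tsum (fun i => ((hm i).mul hexp.aemeasurable).aestronglyMeasurable) ?_).symm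
    refine (lt_of_le_of_lt (le_of_eq ?_) hs).ne
    refine tsum_congr fun i => lintegral_congr fun τ => ?_
    rw [Pi.mul_apply, enorm_mul,
      show Complex.I * t * τ = ((t * τ : ℝ) : ℂ) * Complex.I by push_cast; ring,
      ← ofReal_norm (Complex.exp _), Complex.norm_exp_ofReal_mul_I]
    simp

theorem isTimeFourier_zero : IsTimeFourier (fun _ => 0) 0 := ⟨integrable_zero _ _ _, by simp⟩

theorem enorm_convolution_le (H₁ H₂ : ℝ → ℂ) (τ : ℝ) :
    ‖(H₁ ⋆[ContinuousLinearMap.mul ℂ ℂ] H₂) τ‖ₑ ≤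
      lconv (fun t => ‖H₁ t‖ₑ) (fun t => ‖H₂ t‖ₑ) τ := by
  rw [convolution_def]
  refine (enorm_integral_le_lintegral_enorm _).trans_eq (lintegral_congr fun t => ?_)
  simp

theorem tsum_mul_lconv {ι : Type*} [Countable ι] {f : ι → ℝ → ℝ≥0∞} (hf : ∀ i, Measurable (f i))
    {g : ℝ → ℝ≥0∞} (hg : Measurable g) (c : ι → ℝ≥0∞) :
    lconv (fun t => ∑' i, c i * f i t) g = fun τ => ∑' i, c i * lconv (f i) g τ := by
  ext τ
  unfold lconv
  simp only [← ENNReal.tsum_mul_right]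
  rw [lintegral_tsum fun i => by fun_prop]
  refine tsum_congr fun i => ?_
  rw [← lintegral_const_mul _ (by fun_prop)]
  simp only [mul_assoc]

/-! ### Modes of functions in the Bourgain spaces -/

/-- Measurable representatives are chosen for the later integrals. `xWeighted` does not see the zero
mode, so `U 0 = 0` has to be arranged, which the vanishing spatial mean permits. -/
theorem MemX.exists_transform {ε : ℤˣ} {s b : ℝ} {u : ℝ → ℤ → ℂ} (hu : MemX ε s b u) :
    ∃ U : ℤ → ℝ → ℂ, (∀ n, Measurable (U n)) ∧ (∀ n, IsTimeFourier (fun t => u t n) (U n)) ∧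
      U 0 = 0 ∧ xNorm ε s b u = xWeighted ε s b U := by
  classical
  obtain ⟨h0, hfin⟩ := hu
  unfold xNorm at hfin
  simp only [iInf_lt_top] at hfin
  obtain ⟨U, hU, -⟩ := hfin
  let V : ℤ → ℝ → ℂ := fun n => if n = 0 then 0 else (hU n).1.1.mk (U n)
  have hV : ∀ n, IsTimeFourier (fun t => u t n) (V n) := by
    intro n
    rcases eq_or_ne n 0 with rfl | hn
    · simpa only [V, if_pos, h0] using isTimeFourier_zero
    · simp only [V, if_neg hn]
      have hae := (hU n).1.1.ae_eq_mk
      refine ⟨(hU n).1.congr hae, fun t => ?_⟩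
      rw [(hU n).2 t]
      refine integral_congr_ae ?_
      filter_upwards [hae] with τ hτ
      rw [hτ]
  refine ⟨V, fun n => ?_, hV, by simp [V], xNorm_eq ε s b hV⟩
  rcases eq_or_ne n 0 with rfl | hn
  · simp only [V, if_pos]; exact measurable_zero
  · simp only [V, if_neg hn]
    exact (hU n).1.1.stronglyMeasurable_mk.measurable

/-- The square of the weighted norm of a single mode. -/
noncomputable def modeSq (ε : ℤˣ) (r : ℝ) (U : ℤ → ℝ → ℂ) (n : ℤ) : ℝ≥0∞ :=
  ∫⁻ τ, modWeight r (τ - (ε : ℤ) * (n : ℝ) ^ 2) * ‖U n τ‖ₑ ^ 2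

theorem tsum_modeSq {ε : ℤˣ} {b : ℝ} {U : ℤ → ℝ → ℂ} (hU : U 0 = 0) :
    ∑' n, modeSq ε (2 * b) U n = xWeighted ε 0 b U ^ 2 := by
  have h0 : modeSq ε (2 * b) U 0 = 0 := by simp [modeSq, hU]
  rw [xWeighted, ← ENNReal.rpow_natCast, ← ENNReal.rpow_mul]
  norm_num
  rw [← tsum_subtype_eq_of_support_subset (s := {n : ℤ | n ≠ 0})]
  · rfl
  · intro n hn h
    exact hn (by rw [h, h0])

theorem lintegral_enorm_sq_le {U : ℤ → ℝ → ℂ} (hU : ∀ n, Measurable (U n)) (ε : ℤˣ) (r : ℝ)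
    (n : ℤ) : (∫⁻ τ, ‖U n τ‖ₑ) ^ 2 ≤ (∫⁻ σ, modWeight (-r) σ) * modeSq ε r U n :=
  lintegral_sq_le_modWeight (hU n).enorm r _

/-! ### Absolute convergence -/

theorem tsum_conv_lt_top {f g h : ℤ → ℝ≥0∞} (hf : ∑' n, f n < ∞) (hg : ∑' n, g n ^ 2 < ∞)
    (hh : ∑' n, h n ^ 2 < ∞) (n : ℤ) :
    ∑' ξ, f ξ * ∑' m, g (m - ξ) * h (n - m) < ∞ := by
  have hb : ∀ ξ, ∑' m, g (m - ξ) * h (n - m) ≤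
      ((∑' n, g n ^ 2) * ∑' n, h n ^ 2) ^ (1 / 2 : ℝ) := by
    intro ξ
    rw [← ENNReal.pow_right_strictMono two_ne_zero |>.le_iff_le, ← ENNReal.rpow_natCast (_ ^ _),
      ← ENNReal.rpow_mul]
    refine (tsum_mul_sq_le _ _).trans_eq ?_
    rw [tsum_sub_right (fun m => g m ^ 2), tsum_sub_left (fun m => h m ^ 2)]
    norm_num
  calc _ ≤ ∑' ξ, f ξ * ((∑' n, g n ^ 2) * ∑' n, h n ^ 2) ^ (1 / 2 : ℝ) := by
        gcongr with ξ; exact hb ξ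
    _ = (∑' ξ, f ξ) * ((∑' n, g n ^ 2) * ∑' n, h n ^ 2) ^ (1 / 2 : ℝ) := ENNReal.tsum_mul_right
    _ < ∞ := ENNReal.mul_lt_top hf
        (ENNReal.rpow_lt_top_of_nonneg (by norm_num) (ENNReal.mul_lt_top hg hh).ne)

theorem tsum_trilinear_at_lt_top {f g h : ℤ → ℝ≥0∞} (hf : ∑' n, f n < ∞)
    (hg : ∑' n, g n ^ 2 < ∞) (hh : ∑' n, h n ^ 2 < ∞) (n : ℤ) :
    ∑' x : ℤ × ℤ, f x.2 * g (x.1 - x.2) * h (n - x.1) < ∞ ∧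
    ∑' x : ℤ × ℤ, g x.2 * f (x.1 - x.2) * h (n - x.1) < ∞ ∧
    ∑' x : ℤ × ℤ, g x.2 * h (x.1 - x.2) * f (n - x.1) < ∞ := by
  have e1 : ∑' x : ℤ × ℤ, f x.2 * g (x.1 - x.2) * h (n - x.1) =
      ∑' ξ, f ξ * ∑' m, g (m - ξ) * h (n - m) := by
    rw [ENNReal.tsum_prod', ENNReal.tsum_comm]
    simp only [mul_assoc, ENNReal.tsum_mul_left]
  have e2 : ∑' x : ℤ × ℤ, g x.2 * f (x.1 - x.2) * h (n - x.1) =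
      ∑' x : ℤ × ℤ, f x.2 * g (x.1 - x.2) * h (n - x.1) := by
    rw [ENNReal.tsum_prod', ENNReal.tsum_prod']
    refine tsum_congr fun m => ?_
    rw [← tsum_sub_left _ m]
    refine tsum_congr fun ξ => ?_
    dsimp only
    rw [sub_sub_cancel, mul_comm (g _)]
  have e3 : ∑' x : ℤ × ℤ, g x.2 * h (x.1 - x.2) * f (n - x.1) =
      ∑' ξ, f ξ * ∑' m, g m * h (n - ξ - m) := by
    rw [ENNReal.tsum_prod', ← tsum_sub_left _ n]
    refine tsum_congr fun m => ?_
    dsimp only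
    rw [← ENNReal.tsum_mul_left, sub_sub_cancel]
    refine tsum_congr fun ξ => ?_
    ring
  have h1 := tsum_conv_lt_top hf hg hh n
  refine ⟨e1 ▸ h1, e2 ▸ e1 ▸ h1, ?_⟩
  rw [e3]
  convert h1 using 4 with ξ
  rw [← tsum_sub_right _ ξ]
  refine tsum_congr fun m => ?_
  congr 2
  ring

theorem tsum_mul_lt_top {f g : ℤ → ℝ≥0∞} (hf : ∑' n, f n ^ 2 < ∞) (hg : ∑' n, g n ^ 2 < ∞) :
    ∑' n, f n * g n < ∞ := by
  have h := (tsum_mul_sq_le f g).trans_lt (ENNReal.mul_lt_top hf hg)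
  by_contra hc
  rw [not_lt, top_le_iff] at hc
  rw [hc] at h
  simp at h

theorem decay_sq (r : ℝ) (k : ℤ) : decay r k ^ 2 = decay (2 * r) k := by
  unfold decay
  rw [← ENNReal.ofReal_pow (by positivity), ← Real.exp_nat_mul]
  congr 2
  push_cast
  ring

/-- Since 2(1 - α) > 1, the decay turns the sequence it falls on into an ℓ¹ sequence, and a
convolution of ℓ¹, ℓ² and ℓ² is finite at every point. The decay may fall on any of the three
inputs. -/
theorem tsum_kernel_lt_top {α : ℝ} (hα : 0 ≤ α) (hα' : α < 1 / 2) (ε₁ ε₂ : ℤˣ)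
    {a b c : ℤ → ℝ≥0∞} (ha : ∑' n, a n ^ 2 < ∞) (hb : ∑' n, b n ^ 2 < ∞) (hc : ∑' n, c n ^ 2 < ∞)
    (n : ℤ) :
    ∑' x : ℤ × ℤ, ENNReal.ofReal (bracket x.1 ^ α * bracket (n - x.1 : ℤ) ^ α *
      |normalFormSymbol α 1 ε₁ ε₂ x.2 (x.1 - x.2)|) *
        (a x.2 * b (x.1 - x.2) * c (n - x.1)) < ∞ := by
  have hd : ∑' k, decay (1 - α) k ^ 2 < ∞ := by
    simp only [decay_sq]
    exact tsum_decay_lt_top (by linarith)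
  have h1 := (tsum_trilinear_at_lt_top (tsum_mul_lt_top hd ha) hb hc n).1
  have h2 := (tsum_trilinear_at_lt_top (tsum_mul_lt_top hd hb) ha hc n).2.1
  have h3 := (tsum_trilinear_at_lt_top (tsum_mul_lt_top hd hc) ha hb n).2.2
  refine lt_of_le_of_lt ?_ (ENNReal.mul_lt_top
    (ENNReal.ofReal_lt_top (r := 4 * Real.exp (logJ n + 20 * Real.log 2)))
    (ENNReal.add_lt_top.2 ⟨ENNReal.add_lt_top.2 ⟨h1, h2⟩, h3⟩))
  rw [← ENNReal.tsum_add, ← ENNReal.tsum_add, ← ENNReal.tsum_mul_left]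
  refine ENNReal.tsum_le_tsum fun x => ?_
  calc _ ≤ ENNReal.ofReal (4 * Real.exp (logJ n + 20 * Real.log 2)) *
        (decay (1 - α) x.2 + decay (1 - α) (x.1 - x.2) + decay (1 - α) (n - x.1)) *
        (a x.2 * b (x.1 - x.2) * c (n - x.1)) := by
        gcongr
        unfold decay
        rw [← ENNReal.ofReal_add (by positivity) (by positivity),
          ← ENNReal.ofReal_add (by positivity) (by positivity),
          ← ENNReal.ofReal_mul (by positivity)]
        exact ENNReal.ofReal_le_ofReal (bracket_mul_normalFormSymbol_le hα hα' ε₁ ε₂ n x)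
    _ = _ := by ring

theorem tsum_symbol_lt_top {α : ℝ} (hα : 0 ≤ α) (hα' : α < 1 / 2) (ε₁ ε₂ : ℤˣ)
    {a b : ℤ → ℝ≥0∞} (ha : ∑' n, a n ^ 2 < ∞) (hb : ∑' n, b n ^ 2 < ∞) (m : ℤ) :
    ∑' ξ : ℤ, ENNReal.ofReal |normalFormSymbol α 1 ε₁ ε₂ ξ (m - ξ)| * (a ξ * b (m - ξ)) < ∞ := by
  have hb' : ∑' ξ, b (m - ξ) ^ 2 < ∞ := by rwa [tsum_sub_left (fun k => b k ^ 2)]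
  refine lt_of_le_of_lt ?_ (ENNReal.mul_lt_top (ENNReal.ofReal_lt_top
    (r := 4 * Real.exp (10 * Real.log 2))) (tsum_mul_lt_top ha hb'))
  rw [← ENNReal.tsum_mul_left]
  gcongr with ξ
  exact abs_normalFormSymbol_le_const hα hα' ε₁ ε₂ _ _

end TimeFourier

section Trilinear

open scoped Convolution

/-! ### The transform of the trilinear operator -/

section Transform

variable {α : ℝ} {ε₁ ε₂ : ℤˣ} {u v w : ℝ → ℤ → ℂ} {U V W : ℤ → ℝ → ℂ}

/-- The time Fourier transform of the modes of `T(u, v)`. -/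
noncomputable def normalFormTransform (α : ℝ) (ε₁ ε₂ : ℤˣ) (U V : ℤ → ℝ → ℂ) (m : ℤ) (τ : ℝ) : ℂ :=
  ∑' ξ : ℤ, (normalFormSymbol α 1 ε₁ ε₂ ξ (m - ξ) : ℂ) *
    (U ξ ⋆[ContinuousLinearMap.mul ℂ ℂ] V (m - ξ)) τ

/-- A majorant of `normalFormTransform`. -/
noncomputable def normalFormMajorant (α : ℝ) (ε₁ ε₂ : ℤˣ) (U V : ℤ → ℝ → ℂ) (m : ℤ) (τ : ℝ) :
    ℝ≥0∞ :=
  ∑' ξ : ℤ, ENNReal.ofReal |normalFormSymbol α 1 ε₁ ε₂ ξ (m - ξ)| *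
    lconv (fun t => ‖U ξ t‖ₑ) (fun t => ‖V (m - ξ) t‖ₑ) τ

/-- The time Fourier transform of the modes of `N(T(u, v), w)`. -/
noncomputable def trilinearTransform (α : ℝ) (ε₁ ε₂ : ℤˣ) (U V W : ℤ → ℝ → ℂ) (n : ℤ) (τ : ℝ) :
    ℂ :=
  (outerSymbol α n : ℂ) * ∑' m : ℤ, ((bracket m ^ α * bracket (n - m : ℤ) ^ α : ℝ) : ℂ) *
    (normalFormTransform α ε₁ ε₂ U V m ⋆[ContinuousLinearMap.mul ℂ ℂ] W (n - m)) τ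

theorem enorm_ofReal_mul (x : ℝ) (z : ℂ) : ‖(x : ℂ) * z‖ₑ = ENNReal.ofReal |x| * ‖z‖ₑ := by
  rw [enorm_mul, ← ofReal_norm (x : ℂ), Complex.norm_real, Real.norm_eq_abs]

theorem enorm_normalFormTransform_le (m : ℤ) (τ : ℝ) :
    ‖normalFormTransform α ε₁ ε₂ U V m τ‖ₑ ≤ normalFormMajorant α ε₁ ε₂ U V m τ := by
  refine enorm_tsum_le_tsum_enorm.trans (ENNReal.tsum_le_tsum fun ξ => ?_)
  rw [enorm_ofReal_mul]
  gcongr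
  exact enorm_convolution_le _ _ _

theorem measurable_normalFormMajorant (hU : ∀ n, Measurable (U n)) (hV : ∀ n, Measurable (V n))
    (m : ℤ) : Measurable (normalFormMajorant α ε₁ ε₂ U V m) :=
  Measurable.tsum fun ξ =>
    (measurable_lconv (hU ξ).enorm (hV (m - ξ)).enorm).const_mul _

theorem lintegral_normalFormMajorant (hU : ∀ n, Measurable (U n)) (hV : ∀ n, Measurable (V n))
    (m : ℤ) : ∫⁻ τ, normalFormMajorant α ε₁ ε₂ U V m τ =
      ∑' ξ : ℤ, ENNReal.ofReal |normalFormSymbol α 1 ε₁ ε₂ ξ (m - ξ)| *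
        ((∫⁻ τ, ‖U ξ τ‖ₑ) * ∫⁻ τ, ‖V (m - ξ) τ‖ₑ) := by
  unfold normalFormMajorant
  rw [lintegral_tsum fun ξ =>
    ((measurable_lconv (hU ξ).enorm (hV (m - ξ)).enorm).const_mul _).aemeasurable]
  refine tsum_congr fun ξ => ?_
  rw [lintegral_const_mul _ (measurable_lconv (hU ξ).enorm (hV (m - ξ)).enorm),
    lintegral_lconv (hU ξ).enorm (hV (m - ξ)).enorm]

theorem tsum_lintegral_normalForm_lt_top (hα : 0 ≤ α) (hα' : α < 1 / 2)
    (hUm : ∀ n, Measurable (U n)) (hVm : ∀ n, Measurable (V n))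
    (hUs : ∑' n, (∫⁻ τ, ‖U n τ‖ₑ) ^ 2 < ∞) (hVs : ∑' n, (∫⁻ τ, ‖V n τ‖ₑ) ^ 2 < ∞) (m : ℤ) :
    ∑' ξ, ∫⁻ τ, ‖(normalFormSymbol α 1 ε₁ ε₂ ξ (m - ξ) : ℂ) *
      (U ξ ⋆[ContinuousLinearMap.mul ℂ ℂ] V (m - ξ)) τ‖ₑ < ∞ := by
  refine lt_of_le_of_lt ?_ (tsum_symbol_lt_top hα hα' ε₁ ε₂ hUs hVs m)
  refine ENNReal.tsum_le_tsum fun ξ => ?_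
  rw [← lintegral_lconv (hUm ξ).enorm (hVm (m - ξ)).enorm, ← lintegral_const_mul _
    (measurable_lconv (hUm ξ).enorm (hVm (m - ξ)).enorm)]
  refine lintegral_mono fun τ => ?_
  dsimp only
  rw [enorm_ofReal_mul]
  gcongr
  exact enorm_convolution_le _ _ _

theorem isTimeFourier_normalForm_term (hU : ∀ n, IsTimeFourier (fun t => u t n) (U n))
    (hV : ∀ n, IsTimeFourier (fun t => v t n) (V n)) (m ξ : ℤ) :
    IsTimeFourier (fun t => (normalFormSymbol α 1 ε₁ ε₂ ξ (m - ξ) : ℂ) * u t ξ * v t (m - ξ))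
      (fun τ => (normalFormSymbol α 1 ε₁ ε₂ ξ (m - ξ) : ℂ) *
        (U ξ ⋆[ContinuousLinearMap.mul ℂ ℂ] V (m - ξ)) τ) := by
  simpa only [mul_assoc] using ((hU ξ).mul (hV (m - ξ))).const_mul _

theorem isTimeFourier_normalForm (hα : 0 ≤ α) (hα' : α < 1 / 2)
    (hU : ∀ n, IsTimeFourier (fun t => u t n) (U n))
    (hV : ∀ n, IsTimeFourier (fun t => v t n) (V n))
    (hUm : ∀ n, Measurable (U n)) (hVm : ∀ n, Measurable (V n))
    (hUs : ∑' n, (∫⁻ τ, ‖U n τ‖ₑ) ^ 2 < ∞) (hVs : ∑' n, (∫⁻ τ, ‖V n τ‖ₑ) ^ 2 < ∞) (m : ℤ) :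
    IsTimeFourier (fun t => normalForm α 1 ε₁ ε₂ (u t) (v t) m)
      (normalFormTransform α ε₁ ε₂ U V m) :=
  IsTimeFourier.tsum (fun ξ => isTimeFourier_normalForm_term hU hV m ξ)
    (tsum_lintegral_normalForm_lt_top hα hα' hUm hVm hUs hVs m)

/-- The time integral of a convolution of absolute values factorizes, so the claim reduces to
`tsum_kernel_lt_top` for the L¹ norms of the modes. It yields both the convergence at every time and
the transform term by term. -/
theorem tsum_lintegral_trilinear_lt_top (hα : 0 ≤ α) (hα' : α < 1 / 2)
    (hUm : ∀ n, Measurable (U n)) (hVm : ∀ n, Measurable (V n)) (hWm : ∀ n, Measurable (W n))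
    (hUs : ∑' n, (∫⁻ τ, ‖U n τ‖ₑ) ^ 2 < ∞) (hVs : ∑' n, (∫⁻ τ, ‖V n τ‖ₑ) ^ 2 < ∞)
    (hWs : ∑' n, (∫⁻ τ, ‖W n τ‖ₑ) ^ 2 < ∞) (n : ℤ) :
    ∑' m : ℤ, ∫⁻ τ, ‖((bracket m ^ α * bracket (n - m : ℤ) ^ α : ℝ) : ℂ) *
      (normalFormTransform α ε₁ ε₂ U V m ⋆[ContinuousLinearMap.mul ℂ ℂ] W (n - m)) τ‖ₑ < ∞ := by
  refine lt_of_le_of_lt ?_ (tsum_kernel_lt_top hα hα' ε₁ ε₂ hUs hVs hWs n)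
  rw [ENNReal.tsum_prod']
  refine ENNReal.tsum_le_tsum fun m => ?_
  have hS := measurable_normalFormMajorant (α := α) (ε₁ := ε₁) (ε₂ := ε₂) hUm hVm m
  have hb : 0 ≤ bracket m ^ α * bracket (n - m : ℤ) ^ α :=
    mul_nonneg (Real.rpow_nonneg (bracket_pos _).le _) (Real.rpow_nonneg (bracket_pos _).le _)
  calc _ ≤ ∫⁻ τ, ENNReal.ofReal (bracket m ^ α * bracket (n - m : ℤ) ^ α) *
        lconv (normalFormMajorant α ε₁ ε₂ U V m) (fun t => ‖W (n - m) t‖ₑ) τ := by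
        refine lintegral_mono fun τ => ?_
        dsimp only
        rw [enorm_ofReal_mul, abs_of_nonneg hb]
        gcongr
        refine (enorm_convolution_le _ _ _).trans (lintegral_mono fun t => ?_)
        dsimp only
        gcongr
        exact enorm_normalFormTransform_le m t
    _ = ENNReal.ofReal (bracket m ^ α * bracket (n - m : ℤ) ^ α) *
        ((∑' ξ : ℤ, ENNReal.ofReal |normalFormSymbol α 1 ε₁ ε₂ ξ (m - ξ)| *
        ((∫⁻ τ, ‖U ξ τ‖ₑ) * ∫⁻ τ, ‖V (m - ξ) τ‖ₑ)) * ∫⁻ τ, ‖W (n - m) τ‖ₑ) := by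
        rw [lintegral_const_mul _ (measurable_lconv hS (hWm _).enorm),
          lintegral_lconv hS (hWm _).enorm, lintegral_normalFormMajorant hUm hVm]
    _ = _ := by
        rw [← ENNReal.tsum_mul_right, ← ENNReal.tsum_mul_left]
        refine tsum_congr fun ξ => ?_
        dsimp only
        rw [ENNReal.ofReal_mul hb]
        ring

theorem isTimeFourier_trilinear_term (hα : 0 ≤ α) (hα' : α < 1 / 2)
    (hU : ∀ n, IsTimeFourier (fun t => u t n) (U n))
    (hV : ∀ n, IsTimeFourier (fun t => v t n) (V n))
    (hW : ∀ n, IsTimeFourier (fun t => w t n) (W n))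
    (hUm : ∀ n, Measurable (U n)) (hVm : ∀ n, Measurable (V n))
    (hUs : ∑' n, (∫⁻ τ, ‖U n τ‖ₑ) ^ 2 < ∞) (hVs : ∑' n, (∫⁻ τ, ‖V n τ‖ₑ) ^ 2 < ∞) (n m : ℤ) :
    IsTimeFourier (fun t => bracketNabla α (normalForm α 1 ε₁ ε₂ (u t) (v t)) m *
        bracketNabla α (w t) (n - m))
      (fun τ => ((bracket m ^ α * bracket (n - m : ℤ) ^ α : ℝ) : ℂ) *
        (normalFormTransform α ε₁ ε₂ U V m ⋆[ContinuousLinearMap.mul ℂ ℂ] W (n - m)) τ) := by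
  have h := ((isTimeFourier_normalForm (ε₁ := ε₁) (ε₂ := ε₂) hα hα' hU hV hUm hVm hUs hVs m).mul
    (hW (n - m))).const_mul ((bracket m ^ α * bracket (n - m : ℤ) ^ α : ℝ) : ℂ)
  convert h using 2 with t
  simp only [bracketNabla, multiplier]
  push_cast
  ring

theorem isTimeFourier_trilinear (hα : 0 ≤ α) (hα' : α < 1 / 2)
    (hU : ∀ n, IsTimeFourier (fun t => u t n) (U n))
    (hV : ∀ n, IsTimeFourier (fun t => v t n) (V n))
    (hW : ∀ n, IsTimeFourier (fun t => w t n) (W n))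
    (hUm : ∀ n, Measurable (U n)) (hVm : ∀ n, Measurable (V n)) (hWm : ∀ n, Measurable (W n))
    (hUs : ∑' n, (∫⁻ τ, ‖U n τ‖ₑ) ^ 2 < ∞) (hVs : ∑' n, (∫⁻ τ, ‖V n τ‖ₑ) ^ 2 < ∞)
    (hWs : ∑' n, (∫⁻ τ, ‖W n τ‖ₑ) ^ 2 < ∞) (n : ℤ) :
    IsTimeFourier (fun t => nonlin α (normalForm α 1 ε₁ ε₂ (u t) (v t)) (w t) n)
      (trilinearTransform α ε₁ ε₂ U V W n) := by
  simp only [nonlin_apply]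
  exact (IsTimeFourier.tsum
    (fun m => isTimeFourier_trilinear_term hα hα' hU hV hW hUm hVm hUs hVs n m)
    (tsum_lintegral_trilinear_lt_top hα hα' hUm hVm hWm hUs hVs hWs n)).const_mul _

theorem enorm_trilinearTransform_le (hUm : ∀ n, Measurable (U n)) (hVm : ∀ n, Measurable (V n))
    (hWm : ∀ n, Measurable (W n)) (n : ℤ) (τ : ℝ) :
    ‖trilinearTransform α ε₁ ε₂ U V W n τ‖ₑ ≤
      ∑' x : ℤ × ℤ, ENNReal.ofReal (kernelAbs α ε₁ ε₂ n x) *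
        lconv (lconv (fun t => ‖U x.2 t‖ₑ) (fun t => ‖V (x.1 - x.2) t‖ₑ))
          (fun t => ‖W (n - x.1) t‖ₑ) τ := by
  unfold trilinearTransform
  rw [enorm_ofReal_mul, ENNReal.tsum_prod']
  calc _ ≤ ENNReal.ofReal |outerSymbol α n| * ∑' m : ℤ,
        ENNReal.ofReal (bracket m ^ α * bracket (n - m : ℤ) ^ α) *
        lconv (normalFormMajorant α ε₁ ε₂ U V m) (fun t => ‖W (n - m) t‖ₑ) τ := by
        gcongr
        refine enorm_tsum_le_tsum_enorm.trans (ENNReal.tsum_le_tsum fun m => ?_)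
        have hb : 0 ≤ bracket m ^ α * bracket (n - m : ℤ) ^ α :=
          mul_nonneg (Real.rpow_nonneg (bracket_pos _).le _)
            (Real.rpow_nonneg (bracket_pos _).le _)
        rw [enorm_ofReal_mul, abs_of_nonneg hb]
        gcongr
        refine (enorm_convolution_le _ _ _).trans (lintegral_mono fun t => ?_)
        dsimp only
        gcongr
        exact enorm_normalFormTransform_le m t
    _ = _ := by
        rw [← ENNReal.tsum_mul_left]
        refine tsum_congr fun m => ?_
        have hb : 0 ≤ bracket m ^ α * bracket (n - m : ℤ) ^ α :=
          mul_nonneg (Real.rpow_nonneg (bracket_pos _).le _)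
            (Real.rpow_nonneg (bracket_pos _).le _)
        have := tsum_mul_lconv (fun ξ : ℤ => measurable_lconv (hUm ξ).enorm (hVm (m - ξ)).enorm)
          (hWm (n - m)).enorm
          (fun ξ => ENNReal.ofReal |normalFormSymbol α 1 ε₁ ε₂ ξ (m - ξ)|)
        unfold normalFormMajorant
        rw [this]
        dsimp only
        rw [← ENNReal.tsum_mul_left, ← ENNReal.tsum_mul_left]
        refine tsum_congr fun ξ => ?_
        rw [kernelAbs, ENNReal.ofReal_mul (abs_nonneg _), ENNReal.ofReal_mul hb]
        ring

end Transform

/-! ### The trilinear estimate -/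

theorem modWeight_intCast (r : ℝ) (k : ℤ) :
    modWeight r k = ENNReal.ofReal (Real.exp (r * logJ k)) := by
  rw [modWeight, mul_comm, Real.exp_mul, exp_logJ]

/-- The gain from R contained in `discreteWeight` is compensated by the factor `modWeight`. The case
ζ = 0 is excluded because the kernel need not vanish there; the zero mode of w does instead. -/
theorem ofReal_kernelAbs_mul_le {α γ a κ s : ℝ} (hα : 0 ≤ α) (hαa : α ≤ a / 2) (ha : a ≤ 1)
    (hγ : γ ≤ 1 - a - κ) (hκ : 0 ≤ 1 - a - κ) (ε₁ ε₂ ε₃ : ℤˣ) {n : ℤ} {x : ℤ × ℤ}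
    (hζ : n - x.1 ≠ 0) :
    ENNReal.ofReal (bracket n ^ γ * kernelAbs α ε₁ ε₂ n x) ≤
      8 * discreteWeight a κ s ε₁ ε₂ ε₃ n x * modWeight ((1 - s) / 2) (resonance ε₁ ε₂ ε₃ n x) := by
  by_cases hx : Admissible n x
  · rw [discreteWeight, if_pos hx, modWeight_intCast, show (8 : ℝ≥0∞) = ENNReal.ofReal 8 by simp,
      ← ENNReal.ofReal_mul (by norm_num), ← ENNReal.ofReal_mul (by positivity), mul_assoc,
      ← Real.exp_add]
    refine ENNReal.ofReal_le_ofReal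
      ((bracket_rpow_mul_kernelAbs_le hα hαa ha hγ hκ ε₁ ε₂ hx).trans_eq ?_)
    congr 2
    ring
  · rw [kernelAbs_eq_zero hx hζ, mul_zero, ENNReal.ofReal_zero]
    exact zero_le

theorem lconv_zero_right (f : ℝ → ℝ≥0∞) (τ : ℝ) : lconv f (fun _ => 0) τ = 0 := by
  simp [lconv]

/-- One term of the Minkowski sum. The constant is 144 = 8 · 18, with 18² = 324 from the modulation
estimate. -/
theorem lintegral_trilinear_term_le {α γ a κ s r : ℝ} (h : Exponents a κ s) (hα : 0 ≤ α)
    (hαa : α ≤ a / 2) (hγ : γ ≤ 1 - a - κ) (hr : 1 ≤ r) (ε₁ ε₂ ε₃ : ℤˣ) {U V W : ℤ → ℝ → ℂ}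
    (hUm : ∀ n, Measurable (U n)) (hVm : ∀ n, Measurable (V n)) (hWm : ∀ n, Measurable (W n))
    (hW0 : W 0 = 0) (n : ℤ) (x : ℤ × ℤ) :
    ∫⁻ τ, (modWeight (-((1 - s) / 2)) (τ - (n : ℝ) ^ 2) *
        (ENNReal.ofReal (bracket n ^ γ * kernelAbs α ε₁ ε₂ n x) *
          lconv (lconv (fun t => ‖U x.2 t‖ₑ) (fun t => ‖V (x.1 - x.2) t‖ₑ))
            (fun t => ‖W (n - x.1) t‖ₑ) τ)) ^ 2 ≤
      (144 * (∫⁻ σ, modWeight (-r) σ) * (discreteWeight a κ s ε₁ ε₂ ε₃ n x *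
        (modeSq ε₁ r U x.2 ^ (1 / 2 : ℝ) * modeSq ε₂ r V (x.1 - x.2) ^ (1 / 2 : ℝ) *
          modeSq ε₃ r W (n - x.1) ^ (1 / 2 : ℝ)))) ^ 2 := by
  have half : ∀ y : ℝ≥0∞, (y ^ (1 / 2 : ℝ)) ^ 2 = y := by
    intro y
    rw [← ENNReal.rpow_natCast, ← ENNReal.rpow_mul]
    norm_num
  rcases eq_or_ne (n - x.1) 0 with hζ | hζ
  · simp [hζ, hW0, lconv_zero_right]
  obtain ⟨h1, h2, h3, h4, h5⟩ := id h
  have key := lintegral_modWeight_lconv_le (hUm x.2).enorm (hVm (x.1 - x.2)).enorm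
    (hWm (n - x.1)).enorm (ρ := (1 - s) / 2) (r := r) (by linarith) (by linarith) (by linarith)
    ((n : ℝ) ^ 2) ((ε₁ : ℤ) * (x.2 : ℝ) ^ 2) ((ε₂ : ℤ) * ((x.1 - x.2 : ℤ) : ℝ) ^ 2)
    ((ε₃ : ℤ) * ((n - x.1 : ℤ) : ℝ) ^ 2)
  have hR : (n : ℝ) ^ 2 - (ε₁ : ℤ) * (x.2 : ℝ) ^ 2 - (ε₂ : ℤ) * ((x.1 - x.2 : ℤ) : ℝ) ^ 2 -
      (ε₃ : ℤ) * ((n - x.1 : ℤ) : ℝ) ^ 2 = (resonance ε₁ ε₂ ε₃ n x : ℤ) := by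
    unfold resonance
    push_cast
    ring
  rw [hR] at key
  have hk := ofReal_kernelAbs_mul_le (s := s) hα hαa h2.le hγ (by linarith) ε₁ ε₂ ε₃ hζ
  have htop : discreteWeight a κ s ε₁ ε₂ ε₃ n x ≠ ∞ := by
    unfold discreteWeight
    split_ifs
    exacts [ENNReal.ofReal_ne_top, ENNReal.zero_ne_top]
  calc _ ≤ ∫⁻ τ, (8 * discreteWeight a κ s ε₁ ε₂ ε₃ n x) ^ 2 *
        (modWeight ((1 - s) / 2) (resonance ε₁ ε₂ ε₃ n x) *
          (modWeight (-((1 - s) / 2)) (τ - (n : ℝ) ^ 2) *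
            lconv (lconv (fun t => ‖U x.2 t‖ₑ) (fun t => ‖V (x.1 - x.2) t‖ₑ))
              (fun t => ‖W (n - x.1) t‖ₑ) τ)) ^ 2 := by
        refine lintegral_mono fun τ => ?_
        dsimp only
        rw [← mul_pow]
        refine pow_le_pow_left' ?_ 2
        refine (mul_le_mul_right (mul_le_mul_left hk _) _).trans_eq ?_
        ring
    _ ≤ (8 * discreteWeight a κ s ε₁ ε₂ ε₃ n x) ^ 2 * (324 * (∫⁻ σ, modWeight (-r) σ) ^ 2 *
        (modeSq ε₁ r U x.2 * modeSq ε₂ r V (x.1 - x.2) * modeSq ε₃ r W (n - x.1))) := by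
        rw [lintegral_const_mul' _ _ (ENNReal.pow_ne_top (ENNReal.mul_ne_top (by norm_num) htop))]
        gcongr
        exact key
    _ = _ := by
        simp only [mul_pow, half]
        ring

/-- Minkowski in τ for each n, then the discrete estimate for the sequences of weighted L² norms of
the modes. All bounds are squared, whence the square root in the constant, which does not depend on
the signs. -/
theorem xWeighted_trilinear_le {α γ a κ s b : ℝ} (h : Exponents a κ s) (hα : 0 ≤ α)
    (hαa : α ≤ a / 2) (hγ : γ ≤ 1 - a - κ) (hb : 1 / 2 < b) :
    ∃ C : ℝ≥0, ∀ (ε₁ ε₂ ε₃ : ℤˣ) (U V W : ℤ → ℝ → ℂ), (∀ n, Measurable (U n)) →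
      (∀ n, Measurable (V n)) → (∀ n, Measurable (W n)) → U 0 = 0 → V 0 = 0 → W 0 = 0 →
      xWeighted 1 γ (-(1 / 2) + s / 2) (trilinearTransform α ε₁ ε₂ U V W) ≤
        C * (xWeighted ε₁ 0 b U * xWeighted ε₂ 0 b V * xWeighted ε₃ 0 b W) := by
  obtain ⟨K, hK, hdisc⟩ := discrete_estimate h
  set I := ∫⁻ σ, modWeight (-(2 * b)) σ with hI
  have hIt : I < ∞ := lintegral_modWeight_lt_top (by linarith)
  set M := ((144 * I) ^ 2 * K) ^ (1 / 2 : ℝ) with hM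
  have hMt : M < ∞ := ENNReal.rpow_lt_top_of_nonneg (by norm_num) (ENNReal.mul_lt_top
    (ENNReal.pow_lt_top (ENNReal.mul_lt_top (by norm_num) hIt)) hK).ne
  refine ⟨M.toNNReal, fun ε₁ ε₂ ε₃ U V W hUm hVm hWm hU0 hV0 hW0 => ?_⟩
  rw [ENNReal.coe_toNNReal hMt.ne]
  have half : ∀ y : ℝ≥0∞, (y ^ (1 / 2 : ℝ)) ^ 2 = y := by
    intro y
    rw [← ENNReal.rpow_natCast, ← ENNReal.rpow_mul]
    norm_num
  refine (ENNReal.pow_right_strictMono two_ne_zero).le_iff_le.1 ?_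
  rw [mul_pow, mul_pow, mul_pow, ← tsum_modeSq hU0, ← tsum_modeSq hV0, ← tsum_modeSq hW0, hM, half,
    xWeighted, half]
  have mode : ∀ n : ℤ, ∫⁻ τ : ℝ, ENNReal.ofReal ((1 + |τ - ((1 : ℤˣ) : ℤ) * (n : ℝ) ^ 2|) ^
        (2 * (-(1 / 2) + s / 2)) * bracket n ^ (2 * γ)) *
        ‖trilinearTransform α ε₁ ε₂ U V W n τ‖ₑ ^ 2 ≤
      (144 * I) ^ 2 * (∑' x : ℤ × ℤ, discreteWeight a κ s ε₁ ε₂ ε₃ n x *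
        (modeSq ε₁ (2 * b) U x.2 ^ (1 / 2 : ℝ) * modeSq ε₂ (2 * b) V (x.1 - x.2) ^ (1 / 2 : ℝ) *
          modeSq ε₃ (2 * b) W (n - x.1) ^ (1 / 2 : ℝ))) ^ 2 := by
    intro n
    have hbr := Real.rpow_nonneg (bracket_pos n).le γ
    rw [← mul_pow, ← ENNReal.tsum_mul_left]
    refine le_trans (lintegral_mono fun τ => ?_) (lintegral_tsum_sq_le volume (fun x => ?_)
      fun x => lintegral_trilinear_term_le (r := 2 * b) (γ := γ) h hα hαa hγ (by linarith)
        ε₁ ε₂ ε₃ hUm hVm hWm hW0 n x)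
    · have e : ENNReal.ofReal ((1 + |τ - ((1 : ℤˣ) : ℤ) * (n : ℝ) ^ 2|) ^
          (2 * (-(1 / 2) + s / 2)) * bracket n ^ (2 * γ)) =
          (modWeight (-((1 - s) / 2)) (τ - (n : ℝ) ^ 2) * ENNReal.ofReal (bracket n ^ γ)) ^ 2 := by
        rw [mul_pow, modWeight_sq, modWeight, ← ENNReal.ofReal_pow hbr,
          ← ENNReal.ofReal_mul (by positivity), ← Real.rpow_mul_natCast (bracket_pos n).le]
        push_cast [Units.val_one]
        rw [one_mul]
        congr 3 <;> ring
      dsimp only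
      rw [e, ← mul_pow]
      refine pow_le_pow_left' ?_ 2
      refine (mul_le_mul_right (enorm_trilinearTransform_le hUm hVm hWm n τ) _).trans_eq ?_
      rw [← ENNReal.tsum_mul_left]
      refine tsum_congr fun x => ?_
      rw [ENNReal.ofReal_mul hbr]
      ring
    · refine Measurable.aemeasurable (Measurable.mul ?_ (Measurable.const_mul ?_ _))
      · exact (measurable_modWeight _).comp (measurable_id.sub_const _)
      · exact measurable_lconv (measurable_lconv (hUm _).enorm (hVm _).enorm) (hWm _).enorm
  calc _ ≤ ∑' n : ℤ, ∫⁻ τ : ℝ, ENNReal.ofReal ((1 + |τ - ((1 : ℤˣ) : ℤ) * (n : ℝ) ^ 2|) ^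
        (2 * (-(1 / 2) + s / 2)) * bracket n ^ (2 * γ)) *
        ‖trilinearTransform α ε₁ ε₂ U V W n τ‖ₑ ^ 2 :=
        ENNReal.tsum_comp_le_tsum_of_injective Subtype.val_injective _
    _ ≤ _ := ENNReal.tsum_le_tsum mode
    _ ≤ (144 * I) ^ 2 * (K * ((∑' n, modeSq ε₁ (2 * b) U n) * (∑' n, modeSq ε₂ (2 * b) V n) *
        ∑' n, modeSq ε₃ (2 * b) W n)) := by
        have hd := hdisc ε₁ ε₂ ε₃ (fun n => modeSq ε₁ (2 * b) U n ^ (1 / 2 : ℝ))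
          (fun n => modeSq ε₂ (2 * b) V n ^ (1 / 2 : ℝ))
          (fun n => modeSq ε₃ (2 * b) W n ^ (1 / 2 : ℝ))
        simp only [half] at hd
        rw [ENNReal.tsum_mul_left]
        exact mul_le_mul_right hd _
    _ = _ := by ring

theorem tsum_sq_lintegral_lt_top {ε : ℤˣ} {b : ℝ} (hb : 1 / 2 < b) {U : ℤ → ℝ → ℂ}
    (hUm : ∀ n, Measurable (U n)) (hU0 : U 0 = 0) (hfin : xWeighted ε 0 b U < ∞) :
    ∑' n, (∫⁻ τ, ‖U n τ‖ₑ) ^ 2 < ∞ := by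
  refine lt_of_le_of_lt (ENNReal.tsum_le_tsum fun n => lintegral_enorm_sq_le hUm ε (2 * b) n) ?_
  rw [ENNReal.tsum_mul_left, tsum_modeSq hU0]
  exact ENNReal.mul_lt_top (lintegral_modWeight_lt_top (by linarith)) (ENNReal.pow_lt_top hfin)

end Trilinear

end Boussinesq

/-! ### Choice of the exponents and conclusion -/

open Boussinesq in
theorem mainTheorem2 (α γ : ℝ) (hα₀ : 0 ≤ α) (hα : α < 1 / 2)
    (hγ : γ < min (1 - 2 * α) (1 / 2)) :
    ∃ δ₀ : ℝ, 0 < δ₀ ∧ ∀ δ δ' : ℝ, 0 < δ → δ < δ₀ → 0 < δ' → δ' < δ₀ →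
      ∃ C : ℝ≥0, ∀ (ε₁ ε₂ ε₃ : ℤˣ) (u v w : ℝ → ℤ → ℂ),
        MemX ε₁ 0 (1 / 2 + δ) u → MemX ε₂ 0 (1 / 2 + δ) v → MemX ε₃ 0 (1 / 2 + δ) w →
        -- all series that define `T(u, v)` and `N(T(u, v), w)` converge absolutely
        (∀ (t : ℝ) (n : ℤ), Summable fun ξ : ℤ =>
          (normalFormSymbol α 1 ε₁ ε₂ ξ (n - ξ) : ℂ) * u t ξ * v t (n - ξ)) ∧
        (∀ (t : ℝ) (n : ℤ), Summable fun ξ : ℤ =>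
          bracketNabla α (normalForm α 1 ε₁ ε₂ (u t) (v t)) ξ *
            bracketNabla α (w t) (n - ξ)) ∧
        xNorm 1 γ (-(1 / 2) + δ')
            (fun t => nonlin α (normalForm α 1 ε₁ ε₂ (u t) (v t)) (w t)) ≤
          C * (xNorm ε₁ 0 (1 / 2 + δ) u * xNorm ε₂ 0 (1 / 2 + δ) v *
            xNorm ε₃ 0 (1 / 2 + δ) w) := by
  obtain ⟨hγ₁, hγ₂⟩ := lt_min_iff.1 hγ
  -- The interval is nonempty because γ < 1 - 2α, γ < 1/2 and α < 1/2.
  obtain ⟨a, ha₁, ha₂⟩ : ∃ a, max (2 * α) (1 / 2) < a ∧ a < min (1 - γ) 1 :=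
    exists_between
      (max_lt (lt_min (by linarith) (by linarith)) (lt_min (by linarith) (by norm_num)))
  obtain ⟨ha₃, ha₄⟩ := max_lt_iff.1 ha₁
  obtain ⟨ha₅, ha₆⟩ := lt_min_iff.1 ha₂
  set κ := min (1 - γ - a) ((1 - a) / 10) with hκ
  have hκ₀ : 0 < κ := lt_min (by linarith) (by linarith)
  have hκ₁ : κ ≤ 1 - γ - a := min_le_left _ _
  have hκ₂ : κ ≤ (1 - a) / 10 := min_le_right _ _
  -- With s = 2δ' the output exponent -1/2 + s/2 is -1/2 + δ', and 10 s ≤ κ becomes δ' ≤ κ/20.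
  refine ⟨κ / 20, by positivity, fun δ δ' hδ _ hδ' hδ₀' => ?_⟩
  have hexp : Exponents a κ (2 * δ') :=
    ⟨ha₄, ha₆, by linarith, by linarith, by linarith⟩
  obtain ⟨C, hC⟩ := xWeighted_trilinear_le (γ := γ) (b := 1 / 2 + δ) hexp hα₀ (by linarith)
    (by linarith) (by linarith)
  refine ⟨C, fun ε₁ ε₂ ε₃ u v w hu hv hw => ?_⟩
  obtain ⟨U, hUm, hU, hU0, hUn⟩ := hu.exists_transform
  obtain ⟨V, hVm, hV, hV0, hVn⟩ := hv.exists_transform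
  obtain ⟨W, hWm, hW, hW0, hWn⟩ := hw.exists_transform
  have hb : 1 / 2 < 1 / 2 + δ := by linarith
  have hUs := tsum_sq_lintegral_lt_top hb hUm hU0 (hUn ▸ hu.2)
  have hVs := tsum_sq_lintegral_lt_top hb hVm hV0 (hVn ▸ hv.2)
  have hWs := tsum_sq_lintegral_lt_top hb hWm hW0 (hWn ▸ hw.2)
  refine ⟨fun t n => ?_, fun t n => ?_, ?_⟩
  · exact IsTimeFourier.summable (fun ξ => isTimeFourier_normalForm_term hU hV n ξ)
      (tsum_lintegral_normalForm_lt_top hα₀ hα hUm hVm hUs hVs n) t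
  · exact IsTimeFourier.summable
      (fun m => isTimeFourier_trilinear_term hα₀ hα hU hV hW hUm hVm hUs hVs n m)
      (tsum_lintegral_trilinear_lt_top hα₀ hα hUm hVm hWm hUs hVs hWs n) t
  · rw [hUn, hVn, hWn]
    have key := hC ε₁ ε₂ ε₃ U V W hUm hVm hWm hU0 hV0 hW0
    rw [mul_div_cancel_left₀ δ' two_ne_zero] at key
    exact (iInf₂_le _ fun n =>
      isTimeFourier_trilinear hα₀ hα hU hV hW hUm hVm hWm hUs hVs hWs n).trans key
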